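/- **Conventions.** Let $T$ be a complete first-order theory with monster model $\mathbb M\models T$: for some cardinal $\kappa>|T|$ (where $|T|=|L|+\aleph_0$ for the language $L$ of $T$), $\mathbb M$ is $\kappa$-saturated and strongly $\kappa$-homogeneous. "Small" means of cardinality $<\kappa$. Tuples $a,b,c,\dots$ are small (possibly infinite) tuples from $\mathbb M$, identified with the sets they enumerate when placed in a relation on sets; models $M\models T$ are small elementary substructures of $\mathbb M$; $a\equiv_A b$ means $\mathrm{tp}(a/A)=\mathrm{tp}(b/A)$. A formula $\varphi(x;y)$ has SOP$_1$ if there are tuples $(a_\eta)_{\eta\in 2^{<\omega}}$ in a model of $T$ such that $\{\varphi(x;a_{\eta|n}):n<\omega\}$ is consistent for every $\eta\in 2^\omega$, and $\{\varphi(x;a_\nu),\varphi(x;a_{\eta^\frown 1})\}$ is inconsistent whenever $\eta\in 2^{<\omega}$ and $\nu\trianglerighteq\eta^\frown\langle 0\rangle$. $T$ is NSOP$_1$ if no formula has SOP$_1$. A global type $q\in S(\mathbb M)$ is $A$-invariant if $b\equiv_A b'$ implies $\varphi(x;b)\in q\iff\varphi(x;b')\in q$. A Morley sequence over $A$ in such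 a $q$ is a sequence $(b_i)_{i<\omega}$ with $b_i\models q|_{Ab_{<i}}$ for all $i$. The formula $\varphi(x;b)$ Kim-divides over $A$ if there are an $A$-invariant global type $q\supseteq\mathrm{tp}(b/A)$ and a Morley sequence $(b_i)_{i<\omega}$ over $A$ in $q$ such that $\{\varphi(x;b_i):i<\omega\}$ is inconsistent. A formula Kim-forks over $A$ if it implies a finite disjunction of formulas each of which Kim-divides over $A$, and a type Kim-forks over $A$ if it implies a formula which does. Write $a\perp^{K}_{A}b$ if $\mathrm{tp}(a/Ab)$ does not Kim-fork over $A$. **Theorem.** Assume there is an $\mathrm{Aut}(\mathbb M)$-invariant ternary relation $\perp$ on small subsets of $\mathbb M$ which satisfies the following properties for every model $M\models T$ and all tuples from $\mathbb M$. 1. Strong finite character: if $a\not\perp_M b$, then there is a formula $\varphi(x,b,m)\in\mathrm{tp}(a/bM)$ such that $a'\not\perp_M b$ for every $a'\models\varphi(x,b,m)$. 2. Existence over models: $a\perp_M M$. 3. Monotonicity: $aa'\perp_M bb'$ implies $a\perp_M b$. 4. Symmetry: $a\perp_M b\iff b\perp_M a$. 5. The independence theorem: if $a\perp_M b$, $a'\perp_M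 c$, $b\perp_M c$ and $a\equiv_M a'$, then there is $a''$ with $a''\equiv_{Mb}a$, $a''\equiv_{Mc}a'$ and $a''\perp_M bc$. Then $T$ is NSOP$_1$, and $\perp$ strengthens Kim-independence over models: if $M\models T$ and $a\perp_M b$, then $a\perp^{K}_M b$. If, moreover, $\perp$ satisfies 6. Witnessing: if $a\not\perp_M b$ is witnessed by $\varphi(x;b)$ (that is, $\models\varphi(a;b)$ and $a'\not\perp_M b$ for every $a'\models\varphi(x;b)$), and $(b_i)_{i<\omega}$ is a Morley sequence over $M$ in a global $M$-invariant type extending $\mathrm{tp}(b/M)$, then $\{\varphi(x;b_i):i<\omega\}$ is inconsistent, then $\perp$ equals Kim-independence over models: if $M\models T$, then $a\perp_M b$ if and only if $a\perp^{K}_M b$. -/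

import Mathlib

open FirstOrder FirstOrder.Language Cardinal

universe u v w

namespace KimCriterion

section SOP1

/-- The restriction `η | n`, as a node of `2^{<ω}`, of a branch `η ∈ 2^ω`. -/
def branchNode (η : ℕ → Bool) (n : ℕ) : List Bool :=
  List.ofFn fun i : Fin n => η i

/-- In the structure `N`, the formula `φ(x; y)` has SOP₁, witnessed by tuples `a_η` from `N`
indexed by the nodes `η ∈ 2^{<ω}`. A set of instances of `φ` is consistent if it is
finitely satisfiable in `N`. -/
def FormulaHasSOP1 {L : FirstOrder.Language.{u, v}} (N : Type w) [L.Structure N] {n m : ℕ}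
    (φ : L.Formula (Fin n ⊕ Fin m)) : Prop :=
  ∃ a : List Bool → Fin m → N,
    (∀ η : ℕ → Bool, ∀ s : Finset ℕ, ∃ x : Fin n → N,
      ∀ k ∈ s, φ.Realize (Sum.elim x (a (branchNode η k)))) ∧
    (∀ η ν : List Bool, (η ++ [false]) <+: ν →
      ¬ ∃ x : Fin n → N, φ.Realize (Sum.elim x (a ν)) ∧
        φ.Realize (Sum.elim x (a (η ++ [true]))))

/-- `T` has SOP₁: some formula has SOP₁ in some model of `T`. (By the downward
Löwenheim–Skolem theorem it does not matter in which universe the model lives, as long as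
the universe is at least that of the language.) -/
def HasSOP1 {L : FirstOrder.Language.{u, v}} (T : L.Theory) : Prop :=
  ∃ (N : T.ModelType.{u, v, max u v}) (n m : ℕ) (φ : L.Formula (Fin n ⊕ Fin m)),
    FormulaHasSOP1 N φ

/-- `T` is NSOP₁. -/
def IsNSOP1 {L : FirstOrder.Language.{u, v}} (T : L.Theory) : Prop := ¬ HasSOP1 T

end SOP1

section Monster

/-- `a ≡_A b`: the tuples `a` and `b` have the same type over `A` in the structure `𝕄`. -/
def SameType (L : FirstOrder.Language.{u, v}) {𝕄 : Type w} [L.Structure 𝕄] (A : Set 𝕄) {ι : Type*}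
    (a b : ι → 𝕄) : Prop :=
  ∀ φ : L.Formula (ι ⊕ A),
    φ.Realize (Sum.elim a ((↑) : A → 𝕄)) ↔ φ.Realize (Sum.elim b ((↑) : A → 𝕄))

/-- `𝕄` is a monster model of its theory, where "small" means "of cardinality `< κ`": `κ` is
uncountable and larger than the number of formulas, `𝕄` is `κ`-saturated (every finitely
satisfiable set of formulas over a small set, in a small tuple of variables, is realized), and
`𝕄` is strongly `κ`-homogeneous (two small tuples of the same type are conjugate under an
automorphism). -/
structure IsMonster (L : FirstOrder.Language.{u, v}) (𝕄 : Type w) [L.Structure 𝕄] (κ : Cardinal.{w}) :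
    Prop where
  aleph0_lt : ℵ₀ < κ
  card_lt : Cardinal.lift.{w} L.card < Cardinal.lift.{max u v} κ
  saturated : ∀ (ι : Type w) (A : Set 𝕄), #ι < κ → #A < κ →
    ∀ p : Set (L.Formula (ι ⊕ A)),
      (∀ s : Finset (L.Formula (ι ⊕ A)), (s : Set (L.Formula (ι ⊕ A))) ⊆ p →
        ∃ a : ι → 𝕄, ∀ φ ∈ s, φ.Realize (Sum.elim a ((↑) : A → 𝕄))) →
      ∃ a : ι → 𝕄, ∀ φ ∈ p, φ.Realize (Sum.elim a ((↑) : A → 𝕄))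
  homogeneous : ∀ (ι : Type w), #ι < κ → ∀ a b : ι → 𝕄, SameType L (∅ : Set 𝕄) a b →
    ∃ σ : 𝕄 ≃[L] 𝕄, ∀ i, σ (a i) = b i

end Monster

section Kim

variable {L : FirstOrder.Language.{u, v}} {𝕄 : Type w} [L.Structure 𝕄]

/-- The formula `φ(x; b)` with parameters from `𝕄`, obtained from the `L`-formula `φ(x; y)` by
substituting (the constants naming) the tuple `b` for `y`. -/
def inst {ι β : Type*} (φ : L.Formula (ι ⊕ β)) (b : β → 𝕄) : L[[𝕄]].Formula ι :=
  BoundedFormula.constantsVarsEquiv.symm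
    (Formula.relabel (Sum.elim Sum.inr (fun i => Sum.inl (b i))) φ)

theorem realize_inst {ι β : Type*} (φ : L.Formula (ι ⊕ β)) (b : β → 𝕄) (a : ι → 𝕄) :
    (inst φ b).Realize a ↔ φ.Realize (Sum.elim a b) := by
  unfold inst
  rw [Formula.Realize, ← BoundedFormula.realize_constantsVarsEquiv, Equiv.apply_symm_apply]
  refine (Formula.realize_relabel (φ := φ)).trans ?_
  refine iff_of_eq (congrArg _ ?_)
  funext i
  rcases i with i | i <;> rfl

/-- `S_ι(𝕄)`: the global (complete) types in a tuple of variables indexed by `ι`. -/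
abbrev GlobalType (L : FirstOrder.Language.{u, v}) (𝕄 : Type w) [L.Structure 𝕄] (ι : Type*) :=
  (L.elementaryDiagram 𝕄).CompleteType ι

/-- `φ(x; b) ∈ q`. -/
def GlobalType.Has {ι β : Type*} (q : GlobalType L 𝕄 ι) (φ : L.Formula (ι ⊕ β))
    (b : β → 𝕄) : Prop :=
  Formula.equivSentence (inst φ b) ∈ q

/-- The global type `q` is `A`-invariant. -/
def GlobalType.IsInvariant {ι : Type*} (q : GlobalType L 𝕄 ι) (A : Set 𝕄) : Prop :=
  ∀ (m : ℕ) (φ : L.Formula (ι ⊕ Fin m)) (b b' : Fin m → 𝕄),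
    SameType L A b b' → (q.Has φ b ↔ q.Has φ b')

/-- `a ⊨ q|_A`. As `tp(a/A)` and `q|_A` are complete, this also says that `q ⊇ tp(a/A)`. -/
def GlobalType.RealizedOver {ι : Type*} (q : GlobalType L 𝕄 ι) (A : Set 𝕄) (a : ι → 𝕄) : Prop :=
  ∀ φ : L.Formula (ι ⊕ A),
    q.Has φ ((↑) : A → 𝕄) ↔ φ.Realize (Sum.elim a ((↑) : A → 𝕄))

/-- `(b_i)_{i < ω}` is a Morley sequence over `A` in `q`: `b_i ⊨ q|_{A b_{<i}}` for all `i`. -/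
def IsMorleySequence {ι : Type*} (q : GlobalType L 𝕄 ι) (A : Set 𝕄) (b : ℕ → ι → 𝕄) : Prop :=
  ∀ i : ℕ, q.RealizedOver (A ∪ ⋃ j < i, Set.range (b j)) (b i)

/-- The set of formulas `{φ(x; b_i) : i < ω}` is consistent (finitely satisfiable in `𝕄`). -/
def InstancesConsistent {ξ ι : Type*} (φ : L.Formula (ξ ⊕ ι)) (b : ℕ → ι → 𝕄) : Prop :=
  ∀ s : Finset ℕ, ∃ x : ξ → 𝕄, ∀ i ∈ s, φ.Realize (Sum.elim x (b i))

/-- The formula `φ(x; y)` `q`-divides over `A`. -/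
def QDivides {ξ ι : Type*} (q : GlobalType L 𝕄 ι) (A : Set 𝕄) (φ : L.Formula (ξ ⊕ ι)) : Prop :=
  ∃ b : ℕ → ι → 𝕄, IsMorleySequence q A b ∧ ¬ InstancesConsistent φ b

/-- The formula `φ(x; b)` Kim-divides over `A`. -/
def KimDivides {ξ : Type*} (A : Set 𝕄) {m : ℕ} (φ : L.Formula (ξ ⊕ Fin m))
    (b : Fin m → 𝕄) : Prop :=
  ∃ q : GlobalType L 𝕄 (Fin m), q.IsInvariant A ∧ q.RealizedOver A b ∧ QDivides q A φ

/-- The formula `φ(x; b)` Kim-forks over `A`: it implies a finite (possibly empty) disjunction of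
formulas `ψ_i(x; cⁱ)` which Kim-divide over `A`. -/
def KimForks {ξ : Type*} (A : Set 𝕄) {m : ℕ} (φ : L.Formula (ξ ⊕ Fin m))
    (b : Fin m → 𝕄) : Prop :=
  ∃ (k : ℕ) (l : Fin k → ℕ) (ψ : (i : Fin k) → L.Formula (ξ ⊕ Fin (l i)))
    (c : (i : Fin k) → Fin (l i) → 𝕄),
    (∀ x : ξ → 𝕄, φ.Realize (Sum.elim x b) → ∃ i, (ψ i).Realize (Sum.elim x (c i))) ∧
    ∀ i, KimDivides A (ψ i) (c i)

/-- The type `tp(a/B)` Kim-forks over `A`: it implies a formula `φ(x; c)` which Kim-forks over `A`.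
As `tp(a/B)` is closed under conjunctions, it implies `φ(x; c)` if and only if one of its members
`θ(x)` does. -/
def TypeKimForks (L : FirstOrder.Language.{u, v}) {𝕄 : Type w} [L.Structure 𝕄] {ξ : Type*} (A B : Set 𝕄)
    (a : ξ → 𝕄) : Prop :=
  ∃ (m : ℕ) (φ : L.Formula (ξ ⊕ Fin m)) (c : Fin m → 𝕄),
    (∃ θ : L.Formula (ξ ⊕ B), θ.Realize (Sum.elim a ((↑) : B → 𝕄)) ∧
      ∀ x : ξ → 𝕄, θ.Realize (Sum.elim x ((↑) : B → 𝕄)) → φ.Realize (Sum.elim x c)) ∧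
    KimForks A φ c

/-- Kim-independence `a ⫝ᴷ_A b`: the type `tp(a/Ab)` does not Kim-fork over `A`. -/
def KimIndep (L : FirstOrder.Language.{u, v}) {𝕄 : Type w} [L.Structure 𝕄] {ξ ι : Type*} (A : Set 𝕄)
    (a : ξ → 𝕄) (b : ι → 𝕄) : Prop :=
  ¬ TypeKimForks L A (A ∪ Set.range b) a

end Kim

section Axioms

/-! The properties of a ternary relation `Ind A C B` ("`A` is independent from `B` over `C`") on
small subsets of the monster model `𝕄`. It is applied to tuples through the sets that they
enumerate, so the concatenation of two tuples becomes a union. Models `M ⊨ T` are small elementary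
substructures of `𝕄`, and tuples are indexed by small types. -/

variable (L : FirstOrder.Language.{u, v}) {𝕄 : Type w} [L.Structure 𝕄] (κ : Cardinal.{w})
  (Ind : Set 𝕄 → Set 𝕄 → Set 𝕄 → Prop)

/-- Invariance under `Aut(𝕄)`. -/
def Invariance : Prop :=
  ∀ (σ : 𝕄 ≃[L] 𝕄) (A C B : Set 𝕄), #A < κ → #C < κ → #B < κ →
    (Ind A C B ↔ Ind (σ '' A) (σ '' C) (σ '' B))

/-- Strong finite character. -/
def StrongFiniteCharacter : Prop :=
  ∀ M : L.ElementarySubstructure 𝕄, #M < κ →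
    ∀ (ξ ι : Type w), #ξ < κ → #ι < κ → ∀ (a : ξ → 𝕄) (b : ι → 𝕄),
      ¬ Ind (Set.range a) M (Set.range b) →
      ∃ φ : L.Formula (ξ ⊕ (ι ⊕ M)),
        φ.Realize (Sum.elim a (Sum.elim b ((↑) : M → 𝕄))) ∧
        ∀ a' : ξ → 𝕄, φ.Realize (Sum.elim a' (Sum.elim b ((↑) : M → 𝕄))) →
          ¬ Ind (Set.range a') M (Set.range b)

/-- Existence over models. -/
def ExistenceOverModels : Prop :=
  ∀ M : L.ElementarySubstructure 𝕄, #M < κ →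
    ∀ (ξ : Type w), #ξ < κ → ∀ a : ξ → 𝕄, Ind (Set.range a) M M

/-- Monotonicity. -/
def Monotonicity : Prop :=
  ∀ M : L.ElementarySubstructure 𝕄, #M < κ →
    ∀ (ξ ξ' ι ι' : Type w), #ξ < κ → #ξ' < κ → #ι < κ → #ι' < κ →
    ∀ (a : ξ → 𝕄) (a' : ξ' → 𝕄) (b : ι → 𝕄) (b' : ι' → 𝕄),
      Ind (Set.range a ∪ Set.range a') M (Set.range b ∪ Set.range b') →
      Ind (Set.range a) M (Set.range b)

/-- Symmetry. -/
def Symmetry : Prop :=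
  ∀ M : L.ElementarySubstructure 𝕄, #M < κ →
    ∀ (ξ ι : Type w), #ξ < κ → #ι < κ → ∀ (a : ξ → 𝕄) (b : ι → 𝕄),
      Ind (Set.range a) M (Set.range b) ↔ Ind (Set.range b) M (Set.range a)

/-- The independence theorem over models. -/
def IndependenceTheorem : Prop :=
  ∀ M : L.ElementarySubstructure 𝕄, #M < κ →
    ∀ (ξ ι ι' : Type w), #ξ < κ → #ι < κ → #ι' < κ →
    ∀ (a a' : ξ → 𝕄) (b : ι → 𝕄) (c : ι' → 𝕄),
      Ind (Set.range a) M (Set.range b) → Ind (Set.range a') M (Set.range c) →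
      Ind (Set.range b) M (Set.range c) → SameType L (M : Set 𝕄) a a' →
      ∃ a'' : ξ → 𝕄, SameType L ((M : Set 𝕄) ∪ Set.range b) a'' a ∧
        SameType L ((M : Set 𝕄) ∪ Set.range c) a'' a' ∧
        Ind (Set.range a'') M (Set.range b ∪ Set.range c)

/-- Witnessing. That `φ(x; b)` witnesses the dependence of `a` and `b` over `M` means, as in strong
finite character, that `a` satisfies `φ(x; b)` and that everything that satisfies `φ(x; b)` depends
on `b` over `M`. (Parameters from `M` are allowed: they can be made part of the tuple `b`.) -/
def Witnessing : Prop :=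
  ∀ M : L.ElementarySubstructure 𝕄, #M < κ →
    ∀ (ξ ι : Type w), #ξ < κ → #ι < κ → ∀ (a : ξ → 𝕄) (b : ι → 𝕄) (φ : L.Formula (ξ ⊕ ι)),
      ¬ Ind (Set.range a) M (Set.range b) →
      φ.Realize (Sum.elim a b) →
      (∀ a' : ξ → 𝕄, φ.Realize (Sum.elim a' b) → ¬ Ind (Set.range a') M (Set.range b)) →
      ∀ q : GlobalType L 𝕄 ι, q.IsInvariant M → q.RealizedOver M b →
      ∀ b' : ℕ → ι → 𝕄, IsMorleySequence q M b' → ¬ InstancesConsistent φ b'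

end Axioms

end KimCriterion

/-!
If a formula `φ` had SOP₁, then repeatedly replacing a tree that witnesses this by an average of the
subtrees above the nodes `0ᵏ1` would produce tuples `d₀ i`, `d₁ i` in a model `M`, of the same type
over larger and larger submodels, such that `{φ(x; d₀ i) : i}` is consistent but `φ(x; d₁ i)` and
`φ(x; d₀ j)` are inconsistent for `i < j`. By strong finite character, averages of tuples from `M`
along an ultrafilter can be chosen independent over `M`, so the independence theorem makes
`φ(x; d₁ i)` and `φ(x; d₀ j)` consistent for some `i < j`, a contradiction.

Kim's lemma follows from NSOP₁: if `ψ` is consistent along the Morley sequences in `q`, but not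
along those in `r`, where the invariant types `q` and `r` agree over the base, then in a sequence
which realizes `q` and `r` alternately, conjunctions of instances of `ψ` form trees witnessing SOP₁,
whose branchings are given by automorphisms that exchange a realization of `q` for one of `r`.

If `a` is independent from `b` over `M`, then by the independence theorem the type of `a` over `Mb`
is realized simultaneously along the conjugates of `b` in a coheir Morley sequence, so by Kim's
lemma it does not Kim-fork. Conversely, if `a` is not independent from `b`, then this is due to a
single formula by strong finite character, and this formula Kim-divides by witnessing along a
coheir Morley sequence.
-/

namespace KimCriterion

section Formulas

variable {L : FirstOrder.Language.{u, v}} {N : Type*} [L.Structure N] {ξ β γ ι : Type*}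

theorem realize_relabel_of_comp_eq {φ : L.Formula β} {g : β → γ} {v : γ → N} {w : β → N}
    (h : v ∘ g = w) : (φ.relabel g).Realize v ↔ φ.Realize w := by
  rw [Formula.realize_relabel, h]

theorem realize_relabel_map_right (φ : L.Formula (ξ ⊕ β)) (f : β → γ) (a : ξ → N) (c : γ → N) :
    (φ.relabel (Sum.map id f)).Realize (Sum.elim a c) ↔ φ.Realize (Sum.elim a (c ∘ f)) :=
  realize_relabel_of_comp_eq (Sum.elim_comp_map ..)

theorem realize_relabel_map_left (φ : L.Formula (ξ ⊕ β)) (f : ξ → ι) (a : ι → N) (b : β → N) :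
    (φ.relabel (Sum.map f id)).Realize (Sum.elim a b) ↔ φ.Realize (Sum.elim (a ∘ f) b) :=
  realize_relabel_of_comp_eq (Sum.elim_comp_map ..)

theorem realize_relabel_swap (φ : L.Formula (ξ ⊕ β)) (a : ξ → N) (b : β → N) :
    (φ.relabel Sum.swap).Realize (Sum.elim b a) ↔ φ.Realize (Sum.elim a b) :=
  realize_relabel_of_comp_eq Sum.elim_swap

open Classical in
/-- The number of variables among `y` that occur in `φ(x; y)`. -/
noncomputable def rightArity (φ : L.Formula (ξ ⊕ β)) : ℕ :=
  φ.freeVarFinset.toRight.card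

open Classical in
/-- An enumeration without repetition of the variables among `y` that occur in `φ(x; y)`. -/
noncomputable def rightVars (φ : L.Formula (ξ ⊕ β)) (i : Fin (rightArity φ)) : β :=
  φ.freeVarFinset.toRight.equivFin.symm i

open Classical in
/-- The formula `φ(x; y)`, in which the possibly infinite tuple `y` is cut down to the variables
that occur. -/
noncomputable def restrictRight (φ : L.Formula (ξ ⊕ β)) : L.Formula (ξ ⊕ Fin (rightArity φ)) :=
  BoundedFormula.restrictFreeVar φ fun
    | ⟨Sum.inl x, _⟩ => Sum.inl x
    | ⟨Sum.inr y, h⟩ => Sum.inr (φ.freeVarFinset.toRight.equivFin ⟨y, Finset.mem_toRight.2 h⟩)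

theorem rightVars_injective (φ : L.Formula (ξ ⊕ β)) : Function.Injective (rightVars φ) := by
  classical exact Subtype.val_injective.comp (Equiv.injective _)

theorem realize_restrictRight (φ : L.Formula (ξ ⊕ β)) (a : ξ → N) (b : β → N) :
    (restrictRight φ).Realize (Sum.elim a (b ∘ rightVars φ)) ↔ φ.Realize (Sum.elim a b) := by
  classical
  refine BoundedFormula.realize_restrictFreeVar _ ?_
  rintro ⟨x | y, h⟩
  · rfl
  · exact congrArg (b ∘ Subtype.val) (Equiv.symm_apply_apply _ (_ : φ.freeVarFinset.toRight))

/-- The formula `∃ x, φ(x; y)`, where the tuple `x` may be infinite. -/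
noncomputable def existsLeft (φ : L.Formula (ξ ⊕ β)) : L.Formula β :=
  (restrictRight (φ.relabel Sum.swap)).iExs (Fin _)

theorem realize_existsLeft [Nonempty N] (φ : L.Formula (ξ ⊕ β)) (b : β → N) :
    (existsLeft φ).Realize b ↔ ∃ a : ξ → N, φ.Realize (Sum.elim a b) := by
  rw [existsLeft, Formula.realize_iExs,
    (rightVars_injective _).surjective_comp_right.exists]
  simp only [realize_restrictRight, realize_relabel_swap]

theorem exists_realize_of_elementaryEmbedding {N' : Type*} [L.Structure N'] [Nonempty N]
    (f : N ↪ₑ[L] N') (φ : L.Formula (ξ ⊕ β)) (b : β → N) (a : ξ → N')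
    (h : φ.Realize (Sum.elim a (f ∘ b))) : ∃ a : ξ → N, φ.Realize (Sum.elim a b) := by
  have : Nonempty N' := ‹Nonempty N›.map f
  rw [← realize_existsLeft, ← f.map_formula, realize_existsLeft]
  exact ⟨a, h⟩

/-- The conjunction of the formulas `φ(x; y_i)` for `i ∈ s`. -/
noncomputable def conjOver (φ : L.Formula (ξ ⊕ β)) (s : Finset ι) : L.Formula (ξ ⊕ (ι × β)) :=
  Formula.iInf fun i : s => φ.relabel (Sum.map id (Prod.mk i.1))

theorem realize_conjOver (φ : L.Formula (ξ ⊕ β)) (s : Finset ι) (a : ξ → N) (b : ι → β → N) :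
    (conjOver φ s).Realize (Sum.elim a (Function.uncurry b)) ↔
      ∀ i ∈ s, φ.Realize (Sum.elim a (b i)) := by
  simp only [conjOver, Formula.realize_iInf, realize_relabel_map_right, Subtype.forall]
  rfl

/-- The set `{φ(x; b) : b ∈ B}` of instances of `φ` is realized in `N`. For finite `B` this is
consistency; for infinite `B` it is consistency if `N` is sufficiently saturated. -/
def IsConsistent (φ : L.Formula (ξ ⊕ β)) (B : Set (β → N)) : Prop :=
  ∃ x : ξ → N, ∀ b ∈ B, φ.Realize (Sum.elim x b)

theorem IsConsistent.mono {φ : L.Formula (ξ ⊕ β)} {B C : Set (β → N)} (h : IsConsistent φ C)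
    (hBC : B ⊆ C) : IsConsistent φ B :=
  h.imp fun _ hx b hb => hx b (hBC hb)

/-- The formula in the variables `(y_i)_i` saying that `{φ(x; y_i) : i ∈ s}` is consistent. -/
noncomputable def consOver (φ : L.Formula (ξ ⊕ β)) (s : Finset ι) : L.Formula (ι × β) :=
  existsLeft (conjOver φ s)

theorem realize_consOver [Nonempty N] (φ : L.Formula (ξ ⊕ β)) (s : Finset ι) (b : ι → β → N) :
    (consOver φ s).Realize (Function.uncurry b) ↔ IsConsistent φ (b '' s) := by
  simp only [consOver, realize_existsLeft, realize_conjOver, IsConsistent, Set.forall_mem_image,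
    Finset.mem_coe]

/-- The formula in the variables `(y_i)_i` saying that `{φ(x; y_i) : i ∈ s} ∪ {φ(x; p) : p ∈ P}` is
consistent. -/
noncomputable def consOverUnion (φ : L.Formula (ξ ⊕ β)) (s : Finset ι) (P : Finset (β → N)) :
    L.Formula ((ι × β) ⊕ (P × β)) :=
  (consOver φ (s.disjSum Finset.univ)).relabel (Equiv.sumProdDistrib ι P β)

theorem realize_consOverUnion [Nonempty N] (φ : L.Formula (ξ ⊕ β)) (s : Finset ι)
    (P : Finset (β → N)) (b : ι → β → N) :
    (consOverUnion φ s P).Realize (Sum.elim (Function.uncurry b) fun z => z.1.1 z.2) ↔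
      IsConsistent φ (b '' s ∪ P) := by
  have h : Sum.elim b ((↑) : P → β → N) '' (s.disjSum Finset.univ : Finset (ι ⊕ P)) =
      b '' s ∪ P := by
    ext c
    simp [Finset.mem_disjSum]
  rw [← h, ← realize_consOver]
  refine realize_relabel_of_comp_eq ?_
  ext ⟨i | p, y⟩ <;> rfl

theorem instancesConsistent_iff {L : FirstOrder.Language.{u, v}} {𝕄 : Type w} [L.Structure 𝕄]
    (φ : L.Formula (ξ ⊕ β)) (b : ℕ → β → 𝕄) :
    InstancesConsistent φ b ↔ ∀ s : Finset ℕ, IsConsistent φ (b '' s) := by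
  simp only [InstancesConsistent, IsConsistent, Set.forall_mem_image, Finset.mem_coe]

end Formulas

section IsSmall

/-- The type `γ`, which may live in any universe, has fewer than `κ` elements. -/
def IsSmall (κ : Cardinal.{w}) (γ : Type*) : Prop :=
  ∃ γ' : Type w, #γ' < κ ∧ Nonempty (γ ≃ γ')

variable {κ : Cardinal.{w}} {γ δ N : Type*}

theorem IsSmall.of_lt {γ : Type w} (h : #γ < κ) : IsSmall κ γ := ⟨γ, h, ⟨Equiv.refl γ⟩⟩

theorem IsSmall.lt {γ : Type w} (h : IsSmall κ γ) : #γ < κ := by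
  obtain ⟨γ', h', ⟨e⟩⟩ := h
  rwa [Cardinal.mk_congr e]

theorem IsSmall.of_injective (h : IsSmall κ δ) (f : γ → δ) (hf : Function.Injective f) :
    IsSmall κ γ := by
  obtain ⟨δ', h', ⟨e⟩⟩ := h
  exact ⟨Set.range (e ∘ f), (Cardinal.mk_set_le _).trans_lt h',
    ⟨Equiv.ofInjective _ (e.injective.comp hf)⟩⟩

theorem IsSmall.of_surjective (h : IsSmall κ γ) (f : γ → δ) (hf : Function.Surjective f) :
    IsSmall κ δ :=
  h.of_injective _ (Function.injective_surjInv hf)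

theorem IsSmall.mono {A B : Set N} (h : IsSmall κ B) (hAB : A ⊆ B) : IsSmall κ A :=
  h.of_injective _ (Set.inclusion_injective hAB)

theorem IsSmall.range (h : IsSmall κ γ) (f : γ → δ) : IsSmall κ (Set.range f) :=
  h.of_surjective _ Set.rangeFactorization_surjective

theorem IsSmall.of_countable (hκ : ℵ₀ < κ) (γ : Type*) [Countable γ] : IsSmall κ γ := by
  obtain ⟨f, hf⟩ := exists_injective_nat γ
  exact .of_injective ⟨ULift.{w} ℕ, by simpa using hκ, ⟨Equiv.ulift.symm⟩⟩ f hf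

theorem IsSmall.sum (hκ : ℵ₀ < κ) (h : IsSmall κ γ) (h' : IsSmall κ δ) : IsSmall κ (γ ⊕ δ) := by
  obtain ⟨γ', hγ, ⟨e⟩⟩ := h
  obtain ⟨δ', hδ, ⟨e'⟩⟩ := h'
  exact ⟨γ' ⊕ δ', by simpa using Cardinal.add_lt_of_lt hκ.le hγ hδ, ⟨e.sumCongr e'⟩⟩

theorem IsSmall.union (hκ : ℵ₀ < κ) {A B : Set N} (h : IsSmall κ A) (h' : IsSmall κ B) :
    IsSmall κ ↥(A ∪ B) := by
  simpa [Set.Sum.elim_range] using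
    (h.sum hκ h').range (Sum.elim ((↑) : A → N) ((↑) : B → N))

theorem IsSmall.biUnion_lt (hκ : ℵ₀ < κ) {A : ℕ → Set N} (n : ℕ) (h : ∀ i, IsSmall κ (A i)) :
    IsSmall κ ↥(⋃ i < n, A i) := by
  induction n with
  | zero => simpa using IsSmall.of_countable hκ _
  | succ n ih => exact Set.biUnion_lt_succ A n ▸ ih.union hκ (h n)

end IsSmall

section SameType

variable {L : FirstOrder.Language.{u, v}} {𝕄 : Type w} [L.Structure 𝕄] {A B : Set 𝕄}
  {ξ ι ι' β δ : Type*} {a b c : ι → 𝕄}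

theorem SameType.refl (A : Set 𝕄) (a : ι → 𝕄) : SameType L A a a := fun _ => Iff.rfl

theorem SameType.trans (h : SameType L A a b) (h' : SameType L A b c) : SameType L A a c :=
  fun φ => (h φ).trans (h' φ)

theorem SameType.comp (h : SameType L A a b) (f : ι' → ι) : SameType L A (a ∘ f) (b ∘ f) :=
  fun φ => by simpa only [realize_relabel_map_left] using h (φ.relabel (Sum.map f id))

theorem realize_relabel_mem (φ : L.Formula (ι ⊕ δ)) {p : δ → 𝕄} (hp : ∀ z, p z ∈ A) (a : ι → 𝕄) :
    (φ.relabel (Sum.map id fun z => (⟨p z, hp z⟩ : A))).Realize (Sum.elim a ((↑) : A → 𝕄)) ↔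
      φ.Realize (Sum.elim a p) :=
  realize_relabel_map_right ..

theorem SameType.realize_iff (h : SameType L A a b) (φ : L.Formula (ι ⊕ δ)) {p : δ → 𝕄}
    (hp : ∀ z, p z ∈ A) : φ.Realize (Sum.elim a p) ↔ φ.Realize (Sum.elim b p) := by
  simpa only [realize_relabel_mem] using h (φ.relabel (Sum.map id fun z => ⟨p z, hp z⟩))

theorem SameType.mono (h : SameType L B a b) (hAB : A ⊆ B) : SameType L A a b :=
  fun φ => h.realize_iff φ fun z => hAB z.2

theorem SameType.sumElim_of_mem (h : SameType L A a b) {p : δ → 𝕄} (hp : ∀ z, p z ∈ A) :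
    SameType L A (Sum.elim a p) (Sum.elim b p) := by
  intro φ
  have assoc (c : ι → 𝕄) : Sum.elim c (Sum.elim p ((↑) : A → 𝕄)) ∘ Equiv.sumAssoc _ _ _ =
      Sum.elim (Sum.elim c p) (↑) := by
    ext ((z | z) | z) <;> rfl
  simpa only [Formula.realize_relabel, assoc] using
    h.realize_iff (φ.relabel (Equiv.sumAssoc _ _ _)) (p := Sum.elim p (↑)) (Sum.rec hp (·.2))

theorem SameType.formula_iff (h : SameType L A a b) (θ : L.Formula ι) :
    θ.Realize a ↔ θ.Realize b := by
  simpa only [Formula.realize_relabel, Sum.elim_comp_inl] using h (θ.relabel Sum.inl)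

theorem SameType.isConsistent_iff [Nonempty 𝕄] {a b : ι → β → 𝕄}
    (h : SameType L A (Function.uncurry a) (Function.uncurry b)) (φ : L.Formula (ξ ⊕ β))
    (s : Finset ι) : IsConsistent φ (a '' s) ↔ IsConsistent φ (b '' s) := by
  simpa only [realize_consOver] using h.formula_iff (consOver φ s)

theorem sameType_iff_forall_fin :
    SameType L A a b ↔ ∀ (n : ℕ) (f : Fin n → ι), SameType L A (a ∘ f) (b ∘ f) := by
  refine ⟨fun h n f => h.comp f, fun h φ => ?_⟩
  simpa only [realize_relabel_swap, realize_restrictRight] using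
    h _ (rightVars (φ.relabel Sum.swap)) ((restrictRight (φ.relabel Sum.swap)).relabel Sum.swap)

theorem sameType_of_equiv (σ : 𝕄 ≃[L] 𝕄) (hσ : ∀ x ∈ A, σ x = x) (a : ι → 𝕄) :
    SameType L A a (σ ∘ a) := by
  intro φ
  rw [← StrongHomClass.realize_formula σ, Sum.comp_elim]
  have : σ ∘ ((↑) : A → 𝕄) = (↑) := funext fun z => hσ z z.2
  rw [this]

end SameType

section GlobalType

variable {L : FirstOrder.Language.{u, v}} {𝕄 : Type w} [L.Structure 𝕄] {ι β δ : Type*}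

/-- A model of the elementary diagram of `𝕄`, as an `L`-structure. -/
instance (N : (L.elementaryDiagram 𝕄).ModelType) : L.Structure N :=
  (L.lhomWithConstants 𝕄).reduct N

theorem has_typeOf (N : (L.elementaryDiagram 𝕄).ModelType) (a : ι → N) (φ : L.Formula (ι ⊕ β))
    (b : β → 𝕄) :
    GlobalType.Has ((L.elementaryDiagram 𝕄).typeOf a) φ b ↔
      φ.Realize (Sum.elim a (ElementaryEmbedding.ofModelsElementaryDiagram L 𝕄 N ∘ b)) := by
  refine Theory.CompleteType.formula_mem_typeOf.trans ?_
  rw [inst, Formula.Realize, ← BoundedFormula.realize_constantsVarsEquiv, Equiv.apply_symm_apply]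
  refine realize_relabel_of_comp_eq ?_
  ext (i | i) <;> rfl

theorem GlobalType.has_relabel (q : GlobalType L 𝕄 ι) (φ : L.Formula (ι ⊕ β)) (f : β → δ)
    (b : δ → 𝕄) : q.Has (φ.relabel (Sum.map id f)) b ↔ q.Has φ (b ∘ f) := by
  obtain ⟨N, a, rfl⟩ := Theory.exists_modelType_is_realized_in _ q
  simp only [has_typeOf, realize_relabel_map_right, Function.comp_assoc]

theorem GlobalType.has_restrictRight (q : GlobalType L 𝕄 ι) (φ : L.Formula (ι ⊕ β))
    (b : β → 𝕄) : q.Has (restrictRight φ) (b ∘ rightVars φ) ↔ q.Has φ b := by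
  obtain ⟨N, a, rfl⟩ := Theory.exists_modelType_is_realized_in _ q
  simp only [has_typeOf, ← Function.comp_assoc, realize_restrictRight]

theorem GlobalType.has_not (q : GlobalType L 𝕄 ι) (φ : L.Formula (ι ⊕ β)) (b : β → 𝕄) :
    q.Has φ.not b ↔ ¬ q.Has φ b :=
  q.not_mem_iff _

theorem GlobalType.exists_realize [Nonempty 𝕄] (q : GlobalType L 𝕄 ι)
    (s : Finset (L.Formula (ι ⊕ β))) (b : β → 𝕄) (hs : ∀ φ ∈ s, q.Has φ b) :
    ∃ a : ι → 𝕄, ∀ φ ∈ s, φ.Realize (Sum.elim a b) := by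
  obtain ⟨N, a, rfl⟩ := Theory.exists_modelType_is_realized_in _ q
  simp only [has_typeOf] at hs
  simpa only [Formula.realize_iInf, Subtype.forall] using
    exists_realize_of_elementaryEmbedding (ElementaryEmbedding.ofModelsElementaryDiagram L 𝕄 N)
      (Formula.iInf fun φ : s => φ.1) b a (by
        simpa only [Formula.realize_iInf, Subtype.forall] using hs)

variable {q : GlobalType L 𝕄 ι} {A B : Set 𝕄} {a a' b : ι → 𝕄}

theorem GlobalType.RealizedOver.has_iff (h : q.RealizedOver A a) (φ : L.Formula (ι ⊕ δ))
    {p : δ → 𝕄} (hp : ∀ z, p z ∈ A) : q.Has φ p ↔ φ.Realize (Sum.elim a p) := by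
  rw [← realize_relabel_mem φ hp, ← h, GlobalType.has_relabel]
  rfl

theorem realizedOver_of_forall
    (h : ∀ φ : L.Formula (ι ⊕ A), φ.Realize (Sum.elim a (↑)) → q.Has φ ((↑) : A → 𝕄)) :
    q.RealizedOver A a := by
  refine fun φ => ⟨fun hφ => ?_, h φ⟩
  by_contra hn
  exact (q.has_not _ _).1 (h φ.not (Formula.realize_not.2 hn)) hφ

theorem GlobalType.RealizedOver.mono (h : q.RealizedOver B a) (hAB : A ⊆ B) :
    q.RealizedOver A a :=
  fun φ => h.has_iff φ fun z => hAB z.2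

theorem GlobalType.RealizedOver.sameType (h : q.RealizedOver A a) (h' : q.RealizedOver A a') :
    SameType L A a a' :=
  fun φ => (h φ).symm.trans (h' φ)

theorem GlobalType.IsInvariant.has_iff (hq : q.IsInvariant A) (φ : L.Formula (ι ⊕ δ))
    {b b' : δ → 𝕄} (h : SameType L A b b') : q.Has φ b ↔ q.Has φ b' := by
  rw [← q.has_restrictRight φ, ← q.has_restrictRight φ]
  exact hq _ _ _ _ (h.comp _)

end GlobalType

section AverageType

variable {L : FirstOrder.Language.{u, v}} {𝕄 : Type w} [L.Structure 𝕄] [Nonempty 𝕄]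
  {I ξ ι ι' β : Type*}

/-- The ultrapower of `𝕄` along `U`, as a model of the elementary diagram of `𝕄`. -/
noncomputable def ultrapower (L : FirstOrder.Language.{u, v}) (𝕄 : Type w) [L.Structure 𝕄]
    [Nonempty 𝕄] (U : Ultrafilter I) : (L.elementaryDiagram 𝕄).ModelType where
  Carrier := (U : Filter I).Product fun _ => 𝕄
  struc := Ultraproduct.structure
  is_model :=
    let _ : L[[𝕄]].Structure ((U : Filter I).Product fun _ => 𝕄) := Ultraproduct.structure
    ⟨fun φ hφ => (Ultraproduct.sentence_realize φ).2 (.of_forall fun _ => hφ)⟩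
  nonempty' := Ultraproduct.Product.instNonempty

/-- The average of the tuples `t i` along the ultrafilter `U`: the global type of the tuple which
they represent in the ultrapower of `𝕄`. -/
noncomputable def averageType (L : FirstOrder.Language.{u, v}) {𝕄 : Type w} [L.Structure 𝕄]
    [Nonempty 𝕄] (U : Ultrafilter I) (t : I → ι → 𝕄) : GlobalType L 𝕄 ι :=
  let a (z : ι) : ultrapower L 𝕄 U := Quotient.mk _ fun i => t i z
  (L.elementaryDiagram 𝕄).typeOf a

variable {U : Ultrafilter I} {t : I → ι → 𝕄} {A : Set 𝕄} {g : ι → 𝕄}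

theorem has_averageType (φ : L.Formula (ι ⊕ β)) (b : β → 𝕄) :
    (averageType L U t).Has φ b ↔ ∀ᶠ i in U, φ.Realize (Sum.elim (t i) b) := by
  simp only [← realize_inst]
  exact (Theory.CompleteType.formula_mem_typeOf (M := ultrapower L 𝕄 U)).trans
    (Ultraproduct.realize_formula_cast (inst φ b) fun z i => t i z)

theorem averageType_isInvariant (ht : ∀ i z, t i z ∈ A) : (averageType L U t).IsInvariant A := by
  intro m φ b b' h
  simp only [has_averageType]
  refine Filter.eventually_congr (.of_forall fun i => ?_)
  simpa only [realize_relabel_swap] using h.realize_iff (φ.relabel Sum.swap) (ht i)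

theorem realizedOver_averageType_comp (h : (averageType L U t).RealizedOver A g) (f : ι' → ι) :
    (averageType L U fun i => t i ∘ f).RealizedOver A (g ∘ f) := by
  intro φ
  have := h (φ.relabel (Sum.map f id))
  simpa only [has_averageType, realize_relabel_map_left] using this

theorem isConsistent_iff_eventually {t : I → ι → β → 𝕄} {g : ι → β → 𝕄}
    (h : (averageType L U fun i => Function.uncurry (t i)).RealizedOver A (Function.uncurry g))
    (φ : L.Formula (ξ ⊕ β)) (s : Finset ι) {P : Finset (β → 𝕄)} (hP : ∀ p ∈ P, ∀ z, p z ∈ A) :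
    IsConsistent φ (g '' s ∪ P) ↔ ∀ᶠ i in U, IsConsistent φ (t i '' s ∪ P) := by
  simp only [← realize_consOverUnion, ← has_averageType]
  exact (h.has_iff _ fun z => hP _ z.1.2 _).symm

theorem isConsistent_insert_iff_eventually {t : I → β → 𝕄} {g : β → 𝕄}
    (h : (averageType L U t).RealizedOver A g) (φ : L.Formula (ξ ⊕ β)) {P : Finset (β → 𝕄)}
    (hP : ∀ p ∈ P, ∀ z, p z ∈ A) :
    IsConsistent φ (insert g (P : Set (β → 𝕄))) ↔
      ∀ᶠ i in U, IsConsistent φ (insert (t i) (P : Set (β → 𝕄))) := by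
  have := isConsistent_iff_eventually (g := fun _ : Unit => g) (t := fun i _ => t i)
    (realizedOver_averageType_comp h Prod.snd) φ {()} hP
  simpa only [Finset.coe_singleton, Set.image_singleton, Set.singleton_union] using this

/-- Every type over an elementary substructure `M` is finitely satisfiable in `M`. -/
theorem exists_realizedOver_averageType (M : L.ElementarySubstructure 𝕄) (e : ι → 𝕄) :
    ∃ W : Ultrafilter (ι → M), (averageType L W fun t z => (t z : 𝕄)).RealizedOver M e := by
  classical
  let S (θ : L.Formula (ι ⊕ M)) : Set (ι → M) :=
    {t | θ.Realize (Sum.elim (fun z => (t z : 𝕄)) ((↑) : M → 𝕄))}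
  obtain ⟨W, hW⟩ := Ultrafilter.exists_ultrafilter_of_finite_inter_nonempty
    (S '' {θ | θ.Realize (Sum.elim e ((↑) : M → 𝕄))}) fun T hT => by
      obtain ⟨s, hs, rfl⟩ := Finset.subset_set_image_iff.1 hT
      obtain ⟨t, ht⟩ := exists_realize_of_elementaryEmbedding M.subtype
        (Formula.iInf fun θ : s => θ.1) id e (Formula.realize_iInf.2 fun θ => hs θ.2)
      rw [← M.subtype.map_formula, Sum.comp_elim, Formula.realize_iInf] at ht
      refine ⟨t, ?_⟩
      simp only [Finset.coe_image, Set.sInter_image, Set.mem_iInter]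
      exact fun θ hθ => ht ⟨θ, hθ⟩
  refine ⟨W, realizedOver_of_forall fun θ hθ => has_averageType _ _ |>.2 ?_⟩
  exact hW ⟨θ, hθ, rfl⟩

end AverageType

section Monster

variable {L : FirstOrder.Language.{u, v}} {𝕄 : Type w} [L.Structure 𝕄] {κ : Cardinal.{w}}
  {ξ ι β γ : Type*} {A : Set 𝕄}

theorem IsMonster.exists_realize (h𝕄 : IsMonster L 𝕄 κ) (hγ : IsSmall κ γ) (hA : IsSmall κ A)
    (p : Set (L.Formula (γ ⊕ A)))
    (hp : ∀ s : Finset (L.Formula (γ ⊕ A)), (s : Set (L.Formula (γ ⊕ A))) ⊆ p →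
      ∃ a : γ → 𝕄, ∀ φ ∈ s, φ.Realize (Sum.elim a ((↑) : A → 𝕄))) :
    ∃ a : γ → 𝕄, ∀ φ ∈ p, φ.Realize (Sum.elim a ((↑) : A → 𝕄)) := by
  classical
  obtain ⟨γ', hγ', ⟨e⟩⟩ := hγ
  obtain ⟨a, ha⟩ := h𝕄.saturated γ' A hγ' hA.lt ((fun φ => φ.relabel (Sum.map e id)) '' p) (by
    intro s hs
    obtain ⟨s', hs', rfl⟩ := Finset.subset_set_image_iff.1 hs
    obtain ⟨a, ha⟩ := hp s' hs'
    refine ⟨a ∘ e.symm, ?_⟩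
    simpa only [Finset.forall_mem_image, realize_relabel_map_left, Function.comp_assoc,
      Equiv.symm_comp_self, Function.comp_id] using ha)
  refine ⟨a ∘ e, fun φ hφ => ?_⟩
  simpa only [realize_relabel_map_left] using ha _ ⟨φ, hφ, rfl⟩

theorem IsMonster.exists_equiv (h𝕄 : IsMonster L 𝕄 κ) (hγ : IsSmall κ γ) (hA : IsSmall κ A)
    {a b : γ → 𝕄} (h : SameType L A a b) :
    ∃ σ : 𝕄 ≃[L] 𝕄, (∀ x ∈ A, σ x = x) ∧ ∀ i, σ (a i) = b i := by
  obtain ⟨γ', hγ', ⟨e⟩⟩ := hγ.sum h𝕄.aleph0_lt hA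
  obtain ⟨σ, hσ⟩ := h𝕄.homogeneous γ' hγ' _ _
    (((h.sumElim_of_mem (p := ((↑) : A → 𝕄)) fun z => z.2).comp e.symm).mono A.empty_subset)
  refine ⟨σ, fun x hx => ?_, fun i => ?_⟩
  · simpa using hσ (e (Sum.inr ⟨x, hx⟩))
  · simpa using hσ (e (Sum.inl i))

theorem IsMonster.exists_realizedOver (h𝕄 : IsMonster L 𝕄 κ) [Nonempty 𝕄] (hι : IsSmall κ ι)
    (q : GlobalType L 𝕄 ι) (hA : IsSmall κ A) : ∃ a, q.RealizedOver A a := by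
  obtain ⟨a, ha⟩ := h𝕄.exists_realize hι hA {φ | q.Has φ ((↑) : A → 𝕄)}
    fun s hs => q.exists_realize s _ hs
  refine ⟨a, realizedOver_of_forall fun φ hφ => ?_⟩
  by_contra hn
  exact Formula.realize_not.1 (ha φ.not ((q.has_not _ _).2 hn)) hφ

theorem IsMonster.exists_realize_of_instancesConsistent (h𝕄 : IsMonster L 𝕄 κ) (hξ : IsSmall κ ξ)
    {φ : L.Formula (ξ ⊕ β)} {b : ℕ → β → 𝕄} (h : InstancesConsistent φ b) :
    ∃ a : ξ → 𝕄, ∀ i, φ.Realize (Sum.elim a (b i)) := by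
  classical
  let c (z : ℕ × Fin (rightArity φ)) : 𝕄 := b z.1 (rightVars φ z.2)
  let ψ (i : ℕ) : L.Formula (ξ ⊕ Set.range c) :=
    (restrictRight φ).relabel (Sum.map id fun z => ⟨c (i, z), Set.mem_range_self _⟩)
  have hψ (i : ℕ) (a : ξ → 𝕄) :
      (ψ i).Realize (Sum.elim a (↑)) ↔ φ.Realize (Sum.elim a (b i)) :=
    (realize_relabel_mem ..).trans (realize_restrictRight φ a (b i))
  obtain ⟨a, ha⟩ := h𝕄.exists_realize hξ ((IsSmall.of_countable h𝕄.aleph0_lt _).range c)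
    (ψ '' Set.univ) fun s hs => by
      obtain ⟨s', -, rfl⟩ := Finset.subset_set_image_iff.1 hs
      simpa [Finset.forall_mem_image, hψ] using h s'
  exact ⟨a, fun i => (hψ i a).1 (ha _ ⟨i, trivial, rfl⟩)⟩

end Monster

section MorleySequence

variable {L : FirstOrder.Language.{u, v}} {𝕄 : Type w} [L.Structure 𝕄] {κ : Cardinal.{w}}
  {A : Set 𝕄} {δ ξ ι : Type*}

theorem SameType.sum_realizedOver {q : GlobalType L 𝕄 ι} (hq : q.IsInvariant A) {b b' : δ → 𝕄}
    (h : SameType L A b b') {a a' : ι → 𝕄} (ha : q.RealizedOver (A ∪ Set.range b) a)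
    (ha' : q.RealizedOver (A ∪ Set.range b') a') :
    SameType L A (Sum.elim b a) (Sum.elim b' a') := by
  intro φ
  let f : (δ ⊕ ι) ⊕ A → ι ⊕ (δ ⊕ A) :=
    Sum.elim (Sum.elim (fun z => Sum.inr (Sum.inl z)) Sum.inl) fun z => Sum.inr (Sum.inr z)
  have rearrange (c : δ → 𝕄) (d : ι → 𝕄) :
      φ.Realize (Sum.elim (Sum.elim c d) ((↑) : A → 𝕄)) ↔
        (φ.relabel f).Realize (Sum.elim d (Sum.elim c ((↑) : A → 𝕄))) :=
    (realize_relabel_of_comp_eq (by ext ((z | z) | z) <;> rfl)).symm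
  rw [rearrange, rearrange, ← ha.has_iff, ← ha'.has_iff]
  · exact hq.has_iff _ (h.sumElim_of_mem fun z => z.2)
  · exact Sum.rec (fun z => .inr ⟨z, rfl⟩) fun z => .inl z.2
  · exact Sum.rec (fun z => .inr ⟨z, rfl⟩) fun z => .inl z.2

/-- A Morley sequence over `A` in which the `i`-th term realizes its own global type `s i`. -/
def IsMixedMorleySequence (s : ℕ → GlobalType L 𝕄 ι) (A : Set 𝕄) (x : ℕ → ι → 𝕄) : Prop :=
  ∀ i : ℕ, (s i).RealizedOver (A ∪ ⋃ j < i, Set.range (x j)) (x i)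

/-- A sequence in which each term is chosen to realize `s i` over `A` and its predecessors, if this
is possible. -/
noncomputable def morleySequence [Nonempty 𝕄] (s : ℕ → GlobalType L 𝕄 ι) (A : Set 𝕄) : ℕ → ι → 𝕄
  | i => Classical.epsilon <| (s i).RealizedOver <|
      A ∪ ⋃ j, ⋃ _ : j < i, Set.range (morleySequence s A j)

theorem IsMonster.isMixedMorleySequence_morleySequence [Nonempty 𝕄] (h𝕄 : IsMonster L 𝕄 κ)
    (hι : IsSmall κ ι) (hA : IsSmall κ A) (s : ℕ → GlobalType L 𝕄 ι) :
    IsMixedMorleySequence s A (morleySequence s A) := by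
  intro i
  conv_rhs => rw [morleySequence]
  exact Classical.epsilon_spec <| h𝕄.exists_realizedOver hι (s i) <|
    hA.union h𝕄.aleph0_lt <| .biUnion_lt h𝕄.aleph0_lt i fun j => hι.range _

variable {s : ℕ → GlobalType L 𝕄 ι} {x y : ℕ → ι → 𝕄}

theorem IsMixedMorleySequence.comp_strictMono (hx : IsMixedMorleySequence s A x) {h : ℕ → ℕ}
    (hh : StrictMono h) : IsMixedMorleySequence (s ∘ h) A (x ∘ h) := fun i =>
  (hx (h i)).mono <| Set.union_subset_union_right _ <| Set.iUnion₂_subset fun j hj =>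
    Set.subset_biUnion_of_mem (u := fun j => Set.range (x j)) (show h j < h i from hh hj)

theorem SameType.sum_fin_mixedMorleySequence (hs : ∀ i, (s i).IsInvariant A) {a a' : δ → 𝕄}
    (h : SameType L A a a') (hx : IsMixedMorleySequence s (A ∪ Set.range a) x)
    (hy : IsMixedMorleySequence s (A ∪ Set.range a') y) (n : ℕ) :
    SameType L A (Sum.elim a fun z : Fin n × ι => x z.1 z.2)
      (Sum.elim a' fun z : Fin n × ι => y z.1 z.2) := by
  induction n with
  | zero =>
    convert h.comp (Sum.elim id fun z : Fin 0 × ι => z.1.elim0) using 1 <;>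
      ext (z | ⟨i, z⟩) <;> first | rfl | exact i.elim0
  | succ n ih =>
    have predecessors_subset (c : δ → 𝕄) (x : ℕ → ι → 𝕄) :
        A ∪ Set.range (Sum.elim c fun z : Fin n × ι => x z.1 z.2) ⊆
          A ∪ Set.range c ∪ ⋃ j < n, Set.range (x j) := by
      rintro _ (hz | ⟨z | z, rfl⟩)
      · exact .inl (.inl hz)
      · exact .inl (.inr ⟨z, rfl⟩)
      · exact .inr (Set.mem_biUnion (show (z.1 : ℕ) < n from z.1.2) ⟨z.2, rfl⟩)
    let f : δ ⊕ Fin (n + 1) × ι → (δ ⊕ Fin n × ι) ⊕ ι :=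
      Sum.elim (Sum.inl ∘ Sum.inl) fun z =>
        Fin.lastCases (Sum.inr z.2) (fun i => Sum.inl (Sum.inr (i, z.2))) z.1
    have comp_f (c : δ → 𝕄) (x : ℕ → ι → 𝕄) :
        Sum.elim (Sum.elim c fun z : Fin n × ι => x z.1 z.2) (x n) ∘ f =
          Sum.elim c fun z : Fin (n + 1) × ι => x z.1 z.2 := by
      ext (z | ⟨i, z⟩)
      · rfl
      · cases i using Fin.lastCases <;> simp [f]
    simpa only [comp_f] using (ih.sum_realizedOver (hs n) ((hx n).mono (predecessors_subset a x))
      ((hy n).mono (predecessors_subset a' y))).comp f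

theorem SameType.sum_mixedMorleySequence (hs : ∀ i, (s i).IsInvariant A) {a a' : δ → 𝕄}
    (h : SameType L A a a') (hx : IsMixedMorleySequence s (A ∪ Set.range a) x)
    (hy : IsMixedMorleySequence s (A ∪ Set.range a') y) :
    SameType L A (Sum.elim a (Function.uncurry x)) (Sum.elim a' (Function.uncurry y)) := by
  refine sameType_iff_forall_fin.2 fun k f => ?_
  let index : δ ⊕ ℕ × ι → ℕ := Sum.elim (fun _ => 0) Prod.fst
  let n := Finset.univ.sup (index ∘ f)
  let g : δ ⊕ ℕ × ι → δ ⊕ Fin (n + 1) × ι := Sum.map id (Prod.map (Fin.ofNat (n + 1)) id)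
  have comp_g (c : δ → 𝕄) (x : ℕ → ι → 𝕄) :
      Sum.elim c (fun z : Fin (n + 1) × ι => x z.1 z.2) ∘ g ∘ f =
        Sum.elim c (Function.uncurry x) ∘ f := by
    ext i
    have le_n : index (f i) ≤ n := Finset.le_sup (f := index ∘ f) (Finset.mem_univ i)
    rcases hfi : f i with z | ⟨l, z⟩
    · simp [g, hfi]
    · have : l < n + 1 := by simpa [index, hfi, Nat.lt_succ_iff] using le_n
      simp [g, hfi, Nat.mod_eq_of_lt this]
  simpa only [comp_g] using (h.sum_fin_mixedMorleySequence hs hx hy (n + 1)).comp (g ∘ f)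

theorem IsMixedMorleySequence.sameType (hs : ∀ i, (s i).IsInvariant A)
    (hx : IsMixedMorleySequence s A x) (hy : IsMixedMorleySequence s A y) :
    SameType L A (Function.uncurry x) (Function.uncurry y) := by
  have union_range_elim : A ∪ Set.range (Empty.elim : Empty → 𝕄) = A := by
    rw [Set.range_eq_empty, Set.union_empty]
  exact ((SameType.refl A (Empty.elim : Empty → 𝕄)).sum_mixedMorleySequence hs
    (by rwa [union_range_elim]) (by rwa [union_range_elim])).comp Sum.inr

theorem IsMixedMorleySequence.instancesConsistent_iff [Nonempty 𝕄]
    (hs : ∀ i, (s i).IsInvariant A) (hx : IsMixedMorleySequence s A x)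
    (hy : IsMixedMorleySequence s A y) (φ : L.Formula (ξ ⊕ ι)) :
    InstancesConsistent φ x ↔ InstancesConsistent φ y := by
  simp only [KimCriterion.instancesConsistent_iff, (hx.sameType hs hy).isConsistent_iff φ]

theorem IsMixedMorleySequence.exists_equiv [Countable ι] (h𝕄 : IsMonster L 𝕄 κ)
    (hA : IsSmall κ A) (hs : ∀ i, (s i).IsInvariant A) (hx : IsMixedMorleySequence s A x)
    {i j k : ℕ} (hi : i < k) (hj : j < k) (hij : SameType L A (x i) (x j)) :
    ∃ σ : 𝕄 ≃[L] 𝕄, σ ∘ x i = x j ∧ ∀ l, k ≤ l → σ ∘ x l = x l := by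
  have shift {i : ℕ} (hi : i < k) :
      IsMixedMorleySequence (fun l => s (l + k)) (A ∪ Set.range (x i)) fun l => x (l + k) := by
    refine fun l => (hx (l + k)).mono ?_
    rintro z ((hz | hz) | hz)
    · exact .inl hz
    · exact .inr (Set.mem_biUnion (show i < l + k by lia) hz)
    · obtain ⟨l', hl', hz⟩ := Set.mem_iUnion₂.1 hz
      exact .inr (Set.mem_biUnion (show l' + k < l + k by lia) hz)
  obtain ⟨σ, -, hσ⟩ := h𝕄.exists_equiv (.of_countable h𝕄.aleph0_lt _) hA
    (hij.sum_mixedMorleySequence (fun l => hs (l + k)) (shift hi) (shift hj))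
  refine ⟨σ, funext fun z => hσ (Sum.inl z), fun l hl => funext fun z => ?_⟩
  simpa [Nat.sub_add_cancel hl] using hσ (Sum.inr (l - k, z))

end MorleySequence

section Independence

/-- The standing assumptions on the relation `Ind`: invariance under automorphisms and the
properties (1)–(5). -/
structure IsIndependence (L : FirstOrder.Language.{u, v}) {𝕄 : Type w} [L.Structure 𝕄]
    (κ : Cardinal.{w}) (Ind : Set 𝕄 → Set 𝕄 → Set 𝕄 → Prop) : Prop where
  invariance : Invariance L κ Ind
  strongFiniteCharacter : StrongFiniteCharacter L κ Ind
  existence : ExistenceOverModels L κ Ind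
  monotonicity : Monotonicity L κ Ind
  symmetry : Symmetry L κ Ind
  independenceTheorem : IndependenceTheorem L κ Ind

namespace IsIndependence

variable {L : FirstOrder.Language.{u, v}} {𝕄 : Type w} [L.Structure 𝕄] {κ : Cardinal.{w}}
  {Ind : Set 𝕄 → Set 𝕄 → Set 𝕄 → Prop} {M : L.ElementarySubstructure 𝕄} {A A' B B' C : Set 𝕄}
  {ξ β : Type*}

theorem mono (hI : IsIndependence L κ Ind) (hM : IsSmall κ M) (h : Ind A' M B')
    (hA' : IsSmall κ A') (hB' : IsSmall κ B') (hA : A ⊆ A') (hB : B ⊆ B') : Ind A M B := by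
  have := hI.monotonicity M hM.lt A A' B B' (hA'.mono hA).lt hA'.lt (hB'.mono hB).lt hB'.lt
    (↑) (↑) (↑) (↑)
  simp only [Subtype.range_coe] at this
  rw [Set.union_eq_self_of_subset_left hA, Set.union_eq_self_of_subset_left hB] at this
  exact this h

theorem symm (hI : IsIndependence L κ Ind) (hM : IsSmall κ M) (h : Ind A M B) (hA : IsSmall κ A)
    (hB : IsSmall κ B) : Ind B M A := by
  have := hI.symmetry M hM.lt A B hA.lt hB.lt (↑) (↑)
  simp only [Subtype.range_coe] at this
  exact this.1 h

theorem image (hI : IsIndependence L κ Ind) (hM : IsSmall κ M) (h : Ind A M B) (hA : IsSmall κ A)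
    (hB : IsSmall κ B) (σ : 𝕄 ≃[L] 𝕄) (hσ : ∀ x ∈ M, σ x = x) : Ind (σ '' A) M (σ '' B) := by
  have := (hI.invariance σ A M B hA.lt hM.lt hB.lt).1 h
  rwa [show σ '' (M : Set 𝕄) = M from (Set.image_congr hσ).trans (Set.image_id' _)] at this

theorem of_subset (hI : IsIndependence L κ Ind) (hM : IsSmall κ M) (hA : A ⊆ M)
    (hB : IsSmall κ B) : Ind A M B := by
  have := hI.existence M hM.lt B hB.lt (↑)
  simp only [Subtype.range_coe] at this
  exact hI.mono hM (hI.symm hM this hB hM) hM hB hA subset_rfl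

/-- By strong finite character, the independence of the tuples `t i` from `B` passes to their
average. -/
theorem of_realizedOver_averageType [Nonempty 𝕄] (hI : IsIndependence L κ Ind) (hM : IsSmall κ M)
    {I : Type*} {U : Ultrafilter I} {t : I → β → 𝕄} (ht : ∀ i z, t i z ∈ M) (hB : IsSmall κ B)
    {g : β → 𝕄} (hβ : IsSmall κ β) (hg : (averageType L U t).RealizedOver (M ∪ B) g) :
    Ind (Set.range g) M B := by
  by_contra hn
  have sfc := hI.strongFiniteCharacter M hM.lt (Set.range g) B (hβ.range g).lt hB.lt (↑) (↑)
  simp only [Subtype.range_coe] at sfc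
  obtain ⟨φ, hφ, hφ'⟩ := sfc hn
  rw [← Set.comp_rangeSplitting g, ← (realizedOver_averageType_comp hg _).has_iff φ
    (Sum.rec (fun z => .inr z.2) fun z => .inl z.2), has_averageType] at hφ
  obtain ⟨i, hi⟩ := hφ.exists
  exact hφ' _ hi (hI.of_subset hM (Set.range_subset_iff.2 fun z => ht i _) hB)

theorem amalgam (hI : IsIndependence L κ Ind) (hM : IsSmall κ M) (hξ : IsSmall κ ξ)
    {a a' : ξ → 𝕄} (hB : IsSmall κ B) (hC : IsSmall κ C) (h : Ind (Set.range a) M B)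
    (h' : Ind (Set.range a') M C) (hBC : Ind B M C) (haa' : SameType L (M : Set 𝕄) a a') :
    ∃ a'' : ξ → 𝕄, SameType L (M ∪ B) a'' a ∧ SameType L (M ∪ C) a'' a' ∧
      Ind (Set.range a'') M (B ∪ C) := by
  obtain ⟨ξ', hξ', ⟨e⟩⟩ := hξ
  have := hI.independenceTheorem M hM.lt ξ' B C hξ' hB.lt hC.lt (a ∘ e.symm) (a' ∘ e.symm) (↑) (↑)
  simp only [Subtype.range_coe, e.symm.surjective.range_comp] at this
  obtain ⟨a'', haB, haC, ha⟩ := this h h' hBC (haa'.comp _)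
  refine ⟨a'' ∘ e, ?_, ?_, ?_⟩
  · simpa [Function.comp_assoc] using haB.comp e
  · simpa [Function.comp_assoc] using haC.comp e
  · rwa [e.surjective.range_comp]

theorem amalgam_conjugate (hI : IsIndependence L κ Ind) (hM : IsSmall κ M) (hξ : IsSmall κ ξ)
    (hβ : IsSmall κ β) (hB : IsSmall κ B) {a a' : ξ → 𝕄} {b : β → 𝕄}
    (h' : Ind (Set.range a') M B) (h : Ind (Set.range a) M (Set.range b))
    (haa' : SameType L (M : Set 𝕄) a' a) {σ : 𝕄 ≃[L] 𝕄} (hσ : ∀ x ∈ M, σ x = x)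
    (hBb : Ind B M (Set.range (σ ∘ b))) :
    ∃ a'' : ξ → 𝕄, SameType L (M ∪ B) a'' a' ∧
      SameType L (M ∪ Set.range (σ ∘ b)) a'' (σ ∘ a) ∧
      Ind (Set.range a'') M (B ∪ Set.range (σ ∘ b)) := by
  refine hI.amalgam hM hξ hB (hβ.range _) h' ?_ hBb (haa'.trans (sameType_of_equiv σ hσ a))
  simpa only [Set.range_comp] using hI.image hM h (hξ.range a) (hβ.range b) σ hσ

theorem isConsistent_pair (hI : IsIndependence L κ Ind) (h𝕄 : IsMonster L 𝕄 κ)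
    (hM : IsSmall κ M) (hξ : IsSmall κ ξ) (hβ : IsSmall κ β) {φ : L.Formula (ξ ⊕ β)} {a : ξ → 𝕄}
    {b c : β → 𝕄} (hφ : φ.Realize (Sum.elim a b)) (hab : Ind (Set.range a) M (Set.range b))
    (hbc : Ind (Set.range b) M (Set.range c)) (hsame : SameType L (M : Set 𝕄) b c) :
    IsConsistent φ {b, c} := by
  obtain ⟨σ, hσM, hσ⟩ := h𝕄.exists_equiv hβ hM hsame
  obtain rfl : σ ∘ b = c := funext hσ
  obtain ⟨x, hxb, hxc, -⟩ :=
    hI.amalgam_conjugate hM hξ hβ (hβ.range b) hab hab (.refl _ a) hσM hbc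
  refine ⟨x, ?_⟩
  rintro _ (rfl | rfl)
  · exact (hxb.realize_iff φ fun z => .inr ⟨z, rfl⟩).2 hφ
  · rw [hxc.realize_iff φ fun z => .inr ⟨z, rfl⟩, ← Sum.comp_elim,
      StrongHomClass.realize_formula σ]
    exact hφ

/-- The averages `g₀` and `g₁` of two sequences in `M` can be chosen independent over `M`, so by
the independence theorem `φ(x; g₀)` and `φ(x; g₁)` are consistent if `φ(x; y)` is consistent along
the first sequence. -/
theorem exists_lt_isConsistent_pair [Nonempty 𝕄] (hI : IsIndependence L κ Ind)
    (h𝕄 : IsMonster L 𝕄 κ) (hM : IsSmall κ M) (hξ : IsSmall κ ξ) (hβ : IsSmall κ β)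
    {φ : L.Formula (ξ ⊕ β)} {d₀ d₁ : ℕ → β → 𝕄} (hd₀ : ∀ i z, d₀ i z ∈ M)
    (hd₁ : ∀ i z, d₁ i z ∈ M)
    (heq : ∀ θ : L.Formula (β ⊕ M), ∀ᶠ i in Filter.atTop,
      (θ.Realize (Sum.elim (d₀ i) (↑)) ↔ θ.Realize (Sum.elim (d₁ i) (↑))))
    {a : ξ → 𝕄} (ha : ∀ i, φ.Realize (Sum.elim a (d₀ i))) :
    ∃ i j, i < j ∧ IsConsistent φ {d₁ i, d₀ j} := by
  have hκ := h𝕄.aleph0_lt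
  let U : Ultrafilter ℕ := Filter.hyperfilter ℕ
  have hU : (U : Filter ℕ) ≤ Filter.atTop := Nat.hyperfilter_le_atTop
  obtain ⟨g₀, hg₀⟩ := h𝕄.exists_realizedOver hβ (averageType L U d₀) (hM.union hκ (hξ.range a))
  obtain ⟨g₁, hg₁⟩ := h𝕄.exists_realizedOver hβ (averageType L U d₁) (hM.union hκ (hβ.range g₀))
  have hφ : φ.Realize (Sum.elim a g₀) := by
    rw [← realize_relabel_swap, ← hg₀.has_iff _ fun z => .inr ⟨z, rfl⟩, has_averageType]
    exact .of_forall fun i => by simpa only [realize_relabel_swap] using ha i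
  have hag₀ : Ind (Set.range a) M (Set.range g₀) := hI.symm hM
    (hI.of_realizedOver_averageType hM hd₀ (hξ.range a) hβ hg₀) (hβ.range g₀) (hξ.range a)
  have hg₀g₁ : Ind (Set.range g₀) M (Set.range g₁) := hI.symm hM
    (hI.of_realizedOver_averageType hM hd₁ (hβ.range g₀) hβ hg₁) (hβ.range g₁) (hβ.range g₀)
  have hsame : SameType L (M : Set 𝕄) g₀ g₁ := fun θ => by
    rw [← hg₀.has_iff θ fun z => .inl z.2, ← hg₁.has_iff θ fun z => .inl z.2,
      has_averageType, has_averageType]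
    exact Filter.eventually_congr (hU (heq θ))
  have hcons := hI.isConsistent_pair h𝕄 hM hξ hβ hφ hag₀ hg₀g₁ hsame
  rw [Set.pair_comm, ← Finset.coe_singleton,
    isConsistent_insert_iff_eventually hg₁ φ (by simp)] at hcons
  obtain ⟨i, hi⟩ := hcons.exists
  rw [Finset.coe_singleton, Set.pair_comm, ← Finset.coe_singleton,
    isConsistent_insert_iff_eventually hg₀ φ (by simpa using fun z => .inl (hd₁ i z))] at hi
  obtain ⟨j, hj, hij⟩ := (hi.and (hU (Filter.eventually_gt_atTop i))).exists
  rw [Finset.coe_singleton, Set.pair_comm] at hj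
  exact ⟨i, j, hij, hj⟩

end IsIndependence

end Independence

section SmallModels

variable {L : FirstOrder.Language.{u, v}} {𝕄 : Type w} [L.Structure 𝕄] {κ : Cardinal.{w}}

theorem IsMonster.exists_card (h𝕄 : IsMonster L 𝕄 κ) :
    ∃ μ : Cardinal.{w}, μ < κ ∧ ℵ₀ ≤ μ ∧
      Cardinal.lift.{w} L.card ≤ Cardinal.lift.{max u v} μ := by
  obtain ⟨μ, hμ⟩ := Cardinal.mem_range_lift_of_le h𝕄.card_lt.le
  refine ⟨max μ ℵ₀, max_lt ?_ h𝕄.aleph0_lt, le_max_right _ _, ?_⟩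
  · exact Cardinal.lift_lt.1 (hμ ▸ h𝕄.card_lt)
  · exact hμ ▸ Cardinal.lift_le.2 (le_max_left _ _)

theorem exists_elementarySubstructure_card_le {μ : Cardinal.{w}} (hμ : ℵ₀ ≤ μ)
    (hL : Cardinal.lift.{w} L.card ≤ Cardinal.lift.{max u v} μ) (S : Set 𝕄) (hS : #S ≤ μ) :
    ∃ N : L.ElementarySubstructure 𝕄, S ⊆ N ∧ #N ≤ μ := by
  by_cases h : μ ≤ #𝕄
  · obtain ⟨N, hSN, hN⟩ := exists_elementarySubstructure_card_eq L S μ hμ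
      (Cardinal.lift_le.2 hS) hL (Cardinal.lift_le.2 h)
    exact ⟨N, hSN, (Cardinal.lift_injective hN).le⟩
  · exact ⟨⊤, Set.subset_univ _, (Cardinal.mk_set_le _).trans (le_of_not_ge h)⟩

theorem exists_elementarySubstructure_iUnion (N : ℕ → L.ElementarySubstructure 𝕄)
    (hN : Monotone fun n => (N n : Set 𝕄)) :
    ∃ M : L.ElementarySubstructure 𝕄, (M : Set 𝕄) = ⋃ n, (N n : Set 𝕄) := by
  have h : L.MeetsDefinable (⋃ n, (N n : Set 𝕄)) := by
    intro D hD hdef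
    obtain ⟨A₀, hA₀, hdef'⟩ := Set.definable_iff_finitely_definable.1 hdef
    obtain ⟨n, hn⟩ : ∃ n, (A₀ : Set 𝕄) ⊆ N n :=
      hN.directed_le.exists_mem_subset_of_finset_subset_biUnion (by simpa using hA₀)
    obtain ⟨x, hx, hx'⟩ := (N n).meetsDefinable D hD (hdef'.mono hn)
    exact ⟨x, hx, Set.mem_iUnion.2 ⟨n, hx'⟩⟩
  exact ⟨h.toElementarySubstructure, h.closure_eq_self⟩

theorem card_iUnion_nat_le {μ : Cardinal.{w}} (hμ : ℵ₀ ≤ μ) (A : ℕ → Set 𝕄)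
    (hA : ∀ n, #(A n) ≤ μ) : #(⋃ n, A n) ≤ μ := by
  have := Cardinal.mk_iUnion_le_lift A
  simp only [Cardinal.lift_uzero, Cardinal.mk_nat, Cardinal.lift_aleph0] at this
  exact this.trans (Cardinal.mul_le_of_le hμ hμ (ciSup_le' hA))

theorem eventually_realize_iff_of_sameType {N : ℕ → Set 𝕄} (hN : Monotone N) {M : Set 𝕄}
    (hM : M = ⋃ n, N n) {β : Type*} {d₀ d₁ : ℕ → β → 𝕄}
    (h : ∀ n, SameType L (N n) (d₀ n) (d₁ n)) (θ : L.Formula (β ⊕ M)) :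
    ∀ᶠ i in Filter.atTop,
      (θ.Realize (Sum.elim (d₀ i) (↑)) ↔ θ.Realize (Sum.elim (d₁ i) (↑))) := by
  have hmem (z : Fin (rightArity θ)) : ∃ n, ((rightVars θ z : M) : 𝕄) ∈ N n :=
    Set.mem_iUnion.1 (hM.subset (rightVars θ z).2)
  choose n hn using hmem
  filter_upwards [Filter.eventually_ge_atTop (Finset.univ.sup n)] with i hi
  rw [← realize_restrictRight θ, ← realize_restrictRight θ]
  exact (h i).realize_iff _ fun z => hN ((Finset.le_sup (Finset.mem_univ z)).trans hi) (hn z)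

end SmallModels

section Tree

variable {L : FirstOrder.Language.{u, v}} {𝕄 : Type w} [L.Structure 𝕄] {κ μ : Cardinal.{w}}
  {ξ β : Type*} {φ : L.Formula (ξ ⊕ β)}

/-- The tree of tuples `t` witnesses that `φ` has SOP₁. Moreover, its paths remain consistent
together with the instances of `φ` at `P`, and its nodes are inconsistent with each instance of `φ`
at `Q`. -/
structure IsSOP1Tree (φ : L.Formula (ξ ⊕ β)) (P Q : Set (β → 𝕄)) (t : List Bool → β → 𝕄) :
    Prop where
  consistent (ν : List Bool) : IsConsistent φ (t '' {ρ | ρ <+: ν} ∪ P)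
  inconsistent {η ν : List Bool} (h : η ++ [false] <+: ν) : ¬ IsConsistent φ {t ν, t (η ++ [true])}
  inconsistent_with (ν : List Bool) {q : β → 𝕄} (hq : q ∈ Q) : ¬ IsConsistent φ {t ν, q}

/-- The subtree of `t` above the node `0ᵏ1`. -/
def hangingTree (t : List Bool → β → 𝕄) (k : ℕ) (ν : List Bool) : β → 𝕄 :=
  t (List.replicate k false ++ true :: ν)

variable {P Q : Set (β → 𝕄)} {t : List Bool → β → 𝕄}

theorem IsSOP1Tree.hangingTree (ht : IsSOP1Tree φ P Q t) (k : ℕ) :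
    IsSOP1Tree φ P Q (hangingTree t k) where
  consistent ν := (ht.consistent (List.replicate k false ++ true :: ν)).mono <| by
    refine Set.union_subset_union_left _ ?_
    rintro _ ⟨ρ, hρ, rfl⟩
    exact ⟨_, by simpa using hρ, rfl⟩
  inconsistent {η ν} h := by
    simpa [KimCriterion.hangingTree] using
      ht.inconsistent (η := List.replicate k false ++ true :: η)
        (ν := List.replicate k false ++ true :: ν) (by simpa using h)
  inconsistent_with ν _ hq := ht.inconsistent_with _ hq

theorem IsSOP1Tree.not_isConsistent_hangingTree (ht : IsSOP1Tree φ P Q t) {j k : ℕ} (hjk : j < k)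
    (ν : List Bool) :
    ¬ IsConsistent φ {KimCriterion.hangingTree t k ν, KimCriterion.hangingTree t j []} := by
  refine ht.inconsistent ?_
  obtain ⟨l, rfl⟩ := Nat.exists_eq_add_of_lt hjk
  exact ⟨List.replicate l false ++ true :: ν, by
    simp [add_assoc, Nat.add_comm l 1, List.replicate_add]⟩

theorem IsSOP1Tree.average [Nonempty 𝕄] {P : Finset (β → 𝕄)} {U : Ultrafilter ℕ}
    {E : ℕ → List Bool → β → 𝕄} {A : Set 𝕄}
    (hg : (averageType L U fun k => Function.uncurry (E k)).RealizedOver A (Function.uncurry t))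
    (hP : ∀ p ∈ P, ∀ z, p z ∈ A) (hQ : ∀ q ∈ Q, ∀ z, q z ∈ A)
    (hE : ∀ k, IsSOP1Tree φ P ∅ (E k))
    (hEQ : ∀ q ∈ Q, ∀ᶠ k in U, ∀ ν, ¬ IsConsistent φ {E k ν, q}) : IsSOP1Tree φ P Q t where
  consistent ν := by
    classical
    have inits : {ρ | ρ <+: ν} = (ν.inits.toFinset : Set (List Bool)) := by
      ext
      simp
    rw [inits, isConsistent_iff_eventually hg φ _ hP, ← inits]
    exact .of_forall fun k => (hE k).consistent ν
  inconsistent {η ν} h := by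
    have := isConsistent_iff_eventually hg φ {ν, η ++ [true]} (P := ∅) (by simp)
    simp only [Finset.coe_insert, Finset.coe_singleton, Set.image_pair, Finset.coe_empty,
      Set.union_empty] at this
    rw [this, ← Ultrafilter.eventually_not]
    exact .of_forall fun k => (hE k).inconsistent h
  inconsistent_with ν q hq := by
    have hν : (averageType L U fun k => E k ν).RealizedOver A (t ν) :=
      realizedOver_averageType_comp hg (Prod.mk ν)
    rw [← Finset.coe_singleton, isConsistent_insert_iff_eventually hν φ (by simpa using hQ q hq),
      ← Ultrafilter.eventually_not]
    filter_upwards [hEQ q hq] with k hk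
    simpa only [Finset.coe_singleton] using hk ν

theorem IsSOP1Tree.insert_root (ht : IsSOP1Tree φ P Q t) : IsSOP1Tree φ (insert (t []) P) Q t where
  consistent ν := (ht.consistent ν).mono <| by
    rintro _ (h | rfl | h)
    exacts [.inl h, .inl ⟨[], List.nil_prefix, rfl⟩, .inr h]
  inconsistent := ht.inconsistent
  inconsistent_with := ht.inconsistent_with

theorem IsSOP1Tree.insert_average [Nonempty 𝕄] (ht : IsSOP1Tree φ P Q t) {U : Ultrafilter ℕ}
    {e : ℕ → β → 𝕄} (he : ∀ k, e k ∈ Q) {A : Set 𝕄} {d : β → 𝕄}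
    (hd : (averageType L U e).RealizedOver A d) (hA : ∀ ν z, t ν z ∈ A) :
    IsSOP1Tree φ P (insert d Q) t where
  consistent := ht.consistent
  inconsistent := ht.inconsistent
  inconsistent_with ν q hq := by
    rcases hq with rfl | hq
    · rw [Set.pair_comm, ← Finset.coe_singleton,
        isConsistent_insert_iff_eventually hd φ (by simpa using hA ν), ← Ultrafilter.eventually_not]
      refine .of_forall fun k => ?_
      rw [Finset.coe_singleton, Set.pair_comm]
      exact ht.inconsistent_with ν (he k)
    · exact ht.inconsistent_with ν hq

theorem IsSOP1Tree.mono {Q' : Set (β → 𝕄)} (ht : IsSOP1Tree φ P Q' t) (hQ : Q ⊆ Q') :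
    IsSOP1Tree φ P Q t where
  consistent := ht.consistent
  inconsistent := ht.inconsistent
  inconsistent_with ν _ hq := ht.inconsistent_with ν (hQ hq)

/-- The new tree is an average of the hanging trees, its root is the new member of `P`, and the new
member of `Q` is an average of the roots of the hanging trees. -/
theorem IsSOP1Tree.exists_insert [Nonempty 𝕄] (h𝕄 : IsMonster L 𝕄 κ) [Countable β]
    {P Q : Finset (β → 𝕄)} (ht : IsSOP1Tree φ P Q t) {N : Set 𝕄} (hN : IsSmall κ N)
    (hP : ∀ p ∈ P, ∀ z, p z ∈ N) (hQ : ∀ q ∈ Q, ∀ z, q z ∈ N) :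
    ∃ (t' : List Bool → β → 𝕄) (d : β → 𝕄), SameType L N (t' []) d ∧
      IsSOP1Tree φ (insert (t' []) P) (insert d Q) t' := by
  have hκ := h𝕄.aleph0_lt
  let U : Ultrafilter ℕ := Filter.hyperfilter ℕ
  have hU : (U : Filter ℕ) ≤ Filter.atTop := Nat.hyperfilter_le_atTop
  let E := KimCriterion.hangingTree t
  obtain ⟨g, hg⟩ := h𝕄.exists_realizedOver (.of_countable hκ _)
    (averageType L U fun k => Function.uncurry (E k))
    (hN.union hκ ((IsSmall.of_countable hκ (List Bool × β)).range (Function.uncurry t)))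
  obtain ⟨t', rfl⟩ : ∃ t', Function.uncurry t' = g := ⟨_, Function.uncurry_curry g⟩
  obtain ⟨d, hd⟩ := h𝕄.exists_realizedOver (.of_countable hκ _)
    (averageType L U fun k => E k [])
    (hN.union hκ ((IsSmall.of_countable hκ (List Bool × β)).range (Function.uncurry t')))
  have ht' : IsSOP1Tree φ P (Q ∪ Set.range fun k => E k []) t' := by
    refine .average hg (fun p hp z => .inl (hP p hp z)) ?_
      (fun k => (ht.hangingTree k).mono (Set.empty_subset _)) ?_
    · rintro _ (hq | ⟨k, rfl⟩) z
      exacts [.inl (hQ _ hq z), .inr ⟨(_, z), rfl⟩]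
    · rintro q (hq | ⟨j, rfl⟩)
      · exact .of_forall fun k ν => (ht.hangingTree k).inconsistent_with ν hq
      · filter_upwards [hU (Filter.eventually_gt_atTop j)] with k hk
        exact ht.not_isConsistent_hangingTree hk
  refine ⟨t', d, ?_, ?_⟩
  · exact ((realizedOver_averageType_comp hg (Prod.mk [])).mono Set.subset_union_left).sameType
      (hd.mono Set.subset_union_left)
  · exact (ht'.insert_root.insert_average (fun k => .inr ⟨k, rfl⟩) hd
      fun ν z => .inr ⟨(ν, z), rfl⟩).mono (Set.insert_subset_insert Set.subset_union_left)

/-- A stage of the construction of two sequences out of a tree which witnesses SOP₁: a model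
containing the members of the two sequences that have been chosen (in `pos` and in `neg`), and a
tree that serves to choose the next ones. -/
structure TreeStage (φ : L.Formula (ξ ⊕ β)) (𝕄 : Type w) [L.Structure 𝕄] (μ : Cardinal.{w}) where
  model : L.ElementarySubstructure 𝕄
  card_model_le : #model ≤ μ
  tree : List Bool → β → 𝕄
  pos : Finset (β → 𝕄)
  neg : Finset (β → 𝕄)
  pos_mem : ∀ p ∈ pos, ∀ z, p z ∈ model
  neg_mem : ∀ q ∈ neg, ∀ z, q z ∈ model
  isSOP1Tree : IsSOP1Tree φ pos neg tree

/-- The stage `S'` follows `S` in the construction: the tuples `d₀` and `d₁` have been added to the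
two sequences. -/
structure TreeStage.IsNext (S S' : TreeStage φ 𝕄 μ) (d₀ d₁ : β → 𝕄) : Prop where
  model_subset : (S.model : Set 𝕄) ⊆ S'.model
  pos_subset : S.pos ⊆ S'.pos
  neg_subset : S.neg ⊆ S'.neg
  mem_pos : d₀ ∈ S'.pos
  mem_neg : d₁ ∈ S'.neg
  sameType : SameType L (S.model : Set 𝕄) d₀ d₁
  inconsistent : ∀ q ∈ S.neg, ¬ IsConsistent φ {q, d₀}

theorem TreeStage.exists_isNext [Nonempty 𝕄] (h𝕄 : IsMonster L 𝕄 κ) [Countable β] (hμκ : μ < κ)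
    (hμ : ℵ₀ ≤ μ) (hL : Cardinal.lift.{w} L.card ≤ Cardinal.lift.{max u v} μ)
    (S : TreeStage φ 𝕄 μ) : ∃ S' d₀ d₁, S.IsNext S' d₀ d₁ := by
  classical
  obtain ⟨t, d, hsame, ht⟩ := S.isSOP1Tree.exists_insert h𝕄
    (.of_lt (S.card_model_le.trans_lt hμκ)) S.pos_mem S.neg_mem
  obtain ⟨N, hN, hNμ⟩ := exists_elementarySubstructure_card_le hμ hL
    ((S.model : Set 𝕄) ∪ Set.range (Sum.elim (t []) d))
    ((Cardinal.mk_union_le _ _).trans (Cardinal.add_le_of_le hμ S.card_model_le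
      ((Cardinal.mk_le_aleph0_iff.2 (Set.countable_range _).to_subtype).trans hμ)))
  have model_subset : (S.model : Set 𝕄) ⊆ N := Set.subset_union_left.trans hN
  refine ⟨{ model := N, card_model_le := hNμ, tree := t, pos := insert (t []) S.pos,
            neg := insert d S.neg, pos_mem := ?_, neg_mem := ?_, isSOP1Tree := ?_ },
    t [], d, model_subset, Finset.subset_insert _ _, Finset.subset_insert _ _,
    Finset.mem_insert_self _ _, Finset.mem_insert_self _ _, hsame, fun q hq => ?_⟩
  · exact Finset.forall_mem_insert _ _ _ |>.2
      ⟨fun z => hN (.inr ⟨.inl z, rfl⟩), fun p hp z => model_subset (S.pos_mem p hp z)⟩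
  · exact Finset.forall_mem_insert _ _ _ |>.2
      ⟨fun z => hN (.inr ⟨.inr z, rfl⟩), fun q hq z => model_subset (S.neg_mem q hq z)⟩
  · simpa only [Finset.coe_insert] using ht
  · rw [Set.pair_comm]
    exact ht.inconsistent_with [] (Set.mem_insert_of_mem _ hq)

theorem TreeStage.exists_seq [Nonempty 𝕄] (h𝕄 : IsMonster L 𝕄 κ) [Countable β] (hμκ : μ < κ)
    (hμ : ℵ₀ ≤ μ) (hL : Cardinal.lift.{w} L.card ≤ Cardinal.lift.{max u v} μ)
    (S₀ : TreeStage φ 𝕄 μ) :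
    ∃ (S : ℕ → TreeStage φ 𝕄 μ) (d₀ d₁ : ℕ → β → 𝕄),
      ∀ n, (S n).IsNext (S (n + 1)) (d₀ n) (d₁ n) := by
  choose next d₀ d₁ hnext using TreeStage.exists_isNext (φ := φ) h𝕄 hμκ hμ hL
  refine ⟨fun n => next^[n] S₀, fun n => d₀ (next^[n] S₀), fun n => d₁ (next^[n] S₀), fun n => ?_⟩
  simpa only [Function.iterate_succ_apply'] using hnext (next^[n] S₀)

theorem IsIndependence.not_isSOP1Tree [Nonempty 𝕄] {Ind : Set 𝕄 → Set 𝕄 → Set 𝕄 → Prop}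
    (hI : IsIndependence L κ Ind) (h𝕄 : IsMonster L 𝕄 κ) [Countable β] (hξ : IsSmall κ ξ) :
    ¬ IsSOP1Tree φ ∅ ∅ t := by
  intro ht
  obtain ⟨μ, hμκ, hμ, hL⟩ := h𝕄.exists_card
  obtain ⟨N, -, hN⟩ := exists_elementarySubstructure_card_le hμ hL (∅ : Set 𝕄) (by simp)
  obtain ⟨S, d₀, d₁, hS⟩ := TreeStage.exists_seq h𝕄 hμκ hμ hL
    { model := N, card_model_le := hN, tree := t, pos := ∅, neg := ∅, pos_mem := by simp,
      neg_mem := by simp, isSOP1Tree := by simpa only [Finset.coe_empty] using ht }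
  have model_mono : Monotone fun n => ((S n).model : Set 𝕄) :=
    monotone_nat_of_le_succ fun n => (hS n).model_subset
  have mem_pos {i j : ℕ} (hij : i < j) : d₀ i ∈ (S j).pos :=
    monotone_nat_of_le_succ (f := fun n => (S n).pos) (fun n => (hS n).pos_subset) hij
      (hS i).mem_pos
  have mem_neg {i j : ℕ} (hij : i < j) : d₁ i ∈ (S j).neg :=
    monotone_nat_of_le_succ (f := fun n => (S n).neg) (fun n => (hS n).neg_subset) hij
      (hS i).mem_neg
  obtain ⟨M, hM⟩ := exists_elementarySubstructure_iUnion (fun n => (S n).model) model_mono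
  have model_subset (n : ℕ) : ((S n).model : Set 𝕄) ⊆ M :=
    hM ▸ Set.subset_iUnion (fun n => ((S n).model : Set 𝕄)) n
  have hMκ : IsSmall κ M := .of_lt <| lt_of_le_of_lt
    (hM ▸ card_iUnion_nat_le hμ _ fun n => (S n).card_model_le : #(M : Set 𝕄) ≤ μ) hμκ
  obtain ⟨a, ha⟩ := h𝕄.exists_realize_of_instancesConsistent (φ := φ) (b := d₀) hξ fun s => by
    obtain ⟨n, hn⟩ := s.exists_nat_subset_range
    exact ((S n).isSOP1Tree.consistent []).imp fun x hx i hi =>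
      hx _ (.inr (mem_pos (Finset.mem_range.1 (hn hi))))
  obtain ⟨i, j, hij, hcons⟩ := hI.exists_lt_isConsistent_pair h𝕄 hMκ hξ
    (.of_countable h𝕄.aleph0_lt _)
    (fun i z => model_subset _ ((S (i + 1)).pos_mem _ (mem_pos i.lt_succ_self) z))
    (fun i z => model_subset _ ((S (i + 1)).neg_mem _ (mem_neg i.lt_succ_self) z))
    (eventually_realize_iff_of_sameType model_mono hM fun n => (hS n).sameType) ha
  exact (hS j).inconsistent _ (mem_neg hij) hcons

end Tree

section Compactness

variable {L : FirstOrder.Language.{u, v}} {𝕄 : Type w} [L.Structure 𝕄] {κ : Cardinal.{w}}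
  {N : Type*} [L.Structure N] {ξ β γ : Type*}

/-- The sentence saying that the formulas in `s` are simultaneously satisfiable. -/
noncomputable def satisfiabilitySentence (s : Finset (L.Formula γ)) : L.Sentence :=
  existsLeft ((Formula.iInf fun φ : s => φ.1).relabel Sum.inl)

theorem realize_satisfiabilitySentence [Nonempty N] (s : Finset (L.Formula γ)) :
    N ⊨ satisfiabilitySentence s ↔ ∃ a : γ → N, ∀ φ ∈ s, φ.Realize a := by
  refine (realize_existsLeft _ _).trans (exists_congr fun a => ?_)
  rw [realize_relabel_of_comp_eq (Sum.elim_comp_inl ..), Formula.realize_iInf, Subtype.forall]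

theorem IsMonster.exists_realize_of_elementarilyEquivalent [Nonempty 𝕄] (h𝕄 : IsMonster L 𝕄 κ)
    [Nonempty N] (hN : N ≅[L] 𝕄) (hγ : IsSmall κ γ) (p : Set (L.Formula γ))
    (hp : ∀ s : Finset (L.Formula γ), ↑s ⊆ p → ∃ a : γ → N, ∀ φ ∈ s, φ.Realize a) :
    ∃ a : γ → 𝕄, ∀ φ ∈ p, φ.Realize a := by
  classical
  have realize_inl (φ : L.Formula γ) (a : γ → 𝕄) :
      (φ.relabel Sum.inl).Realize (Sum.elim a ((↑) : (∅ : Set 𝕄) → 𝕄)) ↔ φ.Realize a :=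
    realize_relabel_of_comp_eq (Sum.elim_comp_inl ..)
  obtain ⟨a, ha⟩ := h𝕄.exists_realize hγ (A := ∅) (.of_countable h𝕄.aleph0_lt _)
    ((fun φ => φ.relabel Sum.inl) '' p) fun s hs => by
      obtain ⟨s', hs', rfl⟩ := Finset.subset_set_image_iff.1 hs
      simp only [Finset.forall_mem_image, realize_inl]
      exact (realize_satisfiabilitySentence s').1
        ((hN.realize_sentence _).1 ((realize_satisfiabilitySentence s').2 (hp s' hs')))
  exact ⟨a, fun φ hφ => (realize_inl φ a).1 (ha _ ⟨φ, hφ, rfl⟩)⟩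

/-- The restriction of the tree of tuples `t` to the nodes of length at most `n` satisfies the
conditions on a witness to SOP₁ of `φ`. -/
structure IsSOP1TreeUpTo (φ : L.Formula (ξ ⊕ β)) (n : ℕ) (t : List Bool → β → N) : Prop where
  consistent {ν : List Bool} (hν : ν.length ≤ n) : IsConsistent φ (t '' {ρ | ρ <+: ν})
  inconsistent {η ν : List Bool} (hν : ν.length ≤ n) (h : η ++ [false] <+: ν) :
    ¬ IsConsistent φ {t ν, t (η ++ [true])}

/-- The formulas saying that a tree witnesses SOP₁ of `φ` up to height `n`. -/
def treeFormulas (φ : L.Formula (ξ ⊕ β)) (n : ℕ) : Set (L.Formula (List Bool × β)) :=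
  {ψ | ∃ ν : List Bool, ν.length ≤ n ∧ ψ = consOver φ ν.inits.toFinset} ∪
  {ψ | ∃ η ν : List Bool, ν.length ≤ n ∧ η ++ [false] <+: ν ∧
    ψ = (consOver φ {ν, η ++ [true]}).not}

theorem treeFormulas_mono (φ : L.Formula (ξ ⊕ β)) : Monotone (treeFormulas φ) := by
  rintro m n hmn ψ (⟨ν, hν, h⟩ | ⟨η, ν, hν, h⟩)
  · exact .inl ⟨ν, hν.trans hmn, h⟩
  · exact .inr ⟨η, ν, hν.trans hmn, h⟩

theorem isSOP1TreeUpTo_iff [Nonempty N] {φ : L.Formula (ξ ⊕ β)} {n : ℕ} {t : List Bool → β → N} :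
    IsSOP1TreeUpTo φ n t ↔ ∀ ψ ∈ treeFormulas φ n, ψ.Realize (Function.uncurry t) := by
  have realize_inits (ν : List Bool) :
      (consOver φ ν.inits.toFinset).Realize (Function.uncurry t) ↔
        IsConsistent φ (t '' {ρ | ρ <+: ν}) := by
    simp only [realize_consOver, List.coe_toFinset, List.mem_inits]
  have realize_pair (η ν : List Bool) :
      (consOver φ {ν, η}).not.Realize (Function.uncurry t) ↔ ¬ IsConsistent φ {t ν, t η} := by
    simp only [Formula.realize_not, realize_consOver, Finset.coe_pair, Set.image_pair]
  constructor
  · rintro ht _ (⟨ν, hν, rfl⟩ | ⟨η, ν, hν, h, rfl⟩)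
    · exact (realize_inits ν).2 (ht.consistent hν)
    · exact (realize_pair _ ν).2 (ht.inconsistent hν h)
  · intro ht
    exact ⟨fun {ν} hν => (realize_inits ν).1 (ht _ (.inl ⟨ν, hν, rfl⟩)),
      fun {η ν} hν h => (realize_pair _ ν).1 (ht _ (.inr ⟨η, ν, hν, h, rfl⟩))⟩

theorem IsMonster.exists_isSOP1Tree [Nonempty 𝕄] (h𝕄 : IsMonster L 𝕄 κ) [Countable β] [Nonempty N]
    (hN : N ≅[L] 𝕄) {φ : L.Formula (ξ ⊕ β)}
    (h : ∀ n, ∃ t : List Bool → β → N, IsSOP1TreeUpTo φ n t) :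
    ∃ t : List Bool → β → 𝕄, IsSOP1Tree φ ∅ ∅ t := by
  obtain ⟨g, hg⟩ := h𝕄.exists_realize_of_elementarilyEquivalent hN
    (.of_countable h𝕄.aleph0_lt (List Bool × β)) (⋃ n, treeFormulas φ n) fun s hs => by
      obtain ⟨n, hn⟩ :=
        (treeFormulas_mono φ).directed_le.exists_mem_subset_of_finset_subset_biUnion hs
      obtain ⟨t, ht⟩ := h n
      exact ⟨Function.uncurry t, fun ψ hψ => isSOP1TreeUpTo_iff.1 ht ψ (hn hψ)⟩
  have ht (n : ℕ) : IsSOP1TreeUpTo φ n (Function.curry g) :=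
    isSOP1TreeUpTo_iff.2 fun ψ hψ => hg ψ (Set.mem_iUnion.2 ⟨n, hψ⟩)
  exact ⟨Function.curry g,
    { consistent ν := by simpa only [Set.union_empty] using (ht _).consistent le_rfl
      inconsistent := (ht _).inconsistent le_rfl
      inconsistent_with _ _ hq := hq.elim }⟩

theorem branchNode_getD_length {ν ρ : List Bool} (h : ρ <+: ν) :
    branchNode (fun i => ν.getD i false) ρ.length = ρ := by
  refine List.ext_getElem (by simp [branchNode]) fun i _ hi => ?_
  simp [branchNode, List.getElem?_eq_getElem (hi.trans_le h.length_le), h.getElem hi]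

theorem IsIndependence.isNSOP1 [Nonempty 𝕄] {Ind : Set 𝕄 → Set 𝕄 → Set 𝕄 → Prop}
    (hI : IsIndependence L κ Ind) (h𝕄 : IsMonster L 𝕄 κ) {T : L.Theory} (hT : T.IsComplete)
    [𝕄 ⊨ T] : IsNSOP1 T := by
  rintro ⟨N, n, m, φ, a, ha, ha'⟩
  have hN : (N : Type _) ≅[L] 𝕄 := elementarilyEquivalent_iff.2 fun ψ =>
    (hT.realize_sentence_iff ψ N).trans (hT.realize_sentence_iff ψ 𝕄).symm
  have isSOP1TreeUpTo (k : ℕ) : IsSOP1TreeUpTo φ k a := by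
    refine ⟨fun {ν} _ => ?_, fun {η ν} _ h hc => ha' η ν h ?_⟩
    · obtain ⟨x, hx⟩ := ha (fun i => ν.getD i false) (Finset.range (ν.length + 1))
      refine ⟨x, Set.forall_mem_image.2 fun ρ hρ => ?_⟩
      have := hx ρ.length (Finset.mem_range.2 (Nat.lt_succ_of_le (List.IsPrefix.length_le hρ)))
      rwa [branchNode_getD_length hρ] at this
    · exact hc.imp fun x hx => ⟨hx _ (.inl rfl), hx _ (.inr rfl)⟩
  obtain ⟨t, ht⟩ := h𝕄.exists_isSOP1Tree hN fun k => ⟨a, isSOP1TreeUpTo k⟩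
  exact hI.not_isSOP1Tree h𝕄 (.of_countable h𝕄.aleph0_lt _) ht

end Compactness

section AutomorphismTree

variable {L : FirstOrder.Language.{u, v}} {𝕄 : Type w} [L.Structure 𝕄] {ξ β γ : Type*}

theorem coe_equiv_comp_comp (σ τ : 𝕄 ≃[L] 𝕄) (c : γ → 𝕄) : σ.comp τ ∘ c = σ ∘ τ ∘ c :=
  rfl

theorem realize_equiv_comp (σ : 𝕄 ≃[L] 𝕄) (φ : L.Formula (ξ ⊕ β)) (a : ξ → 𝕄) (b : β → 𝕄) :
    φ.Realize (Sum.elim (σ ∘ a) (σ ∘ b)) ↔ φ.Realize (Sum.elim a b) := by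
  rw [← Sum.comp_elim]
  exact StrongHomClass.realize_formula σ φ

theorem realize_equiv_comp_right (σ : 𝕄 ≃[L] 𝕄) (φ : L.Formula (ξ ⊕ β)) (a : ξ → 𝕄) (b : β → 𝕄) :
    φ.Realize (Sum.elim a (σ ∘ b)) ↔ φ.Realize (Sum.elim (σ.symm ∘ a) b) := by
  rw [← realize_equiv_comp σ φ (σ.symm ∘ a), ← coe_equiv_comp_comp, Language.Equiv.self_comp_symm]
  rfl

/-- The composition, in increasing order, of the automorphisms `σ i` for those `i` at which the node
`η` has the entry `1`. -/
def nodeEquiv (σ : ℕ → 𝕄 ≃[L] 𝕄) : List Bool → 𝕄 ≃[L] 𝕄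
  | [] => .refl L 𝕄
  | b :: η => (bif b then σ 0 else .refl L 𝕄).comp (nodeEquiv (fun i => σ (i + 1)) η)

theorem nodeEquiv_append (σ : ℕ → 𝕄 ≃[L] 𝕄) (η ρ : List Bool) :
    nodeEquiv σ (η ++ ρ) = (nodeEquiv σ η).comp (nodeEquiv (fun i => σ (i + η.length)) ρ) := by
  induction η generalizing σ with
  | nil => rfl
  | cons b η ih =>
    simp only [List.cons_append, nodeEquiv, ih, Language.Equiv.comp_assoc, List.length_cons,
      add_assoc]

theorem nodeEquiv_append_singleton (σ : ℕ → 𝕄 ≃[L] 𝕄) (η : List Bool) (b : Bool) :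
    nodeEquiv σ (η ++ [b]) = (nodeEquiv σ η).comp (bif b then σ η.length else .refl L 𝕄) := by
  rw [nodeEquiv_append]
  simp [nodeEquiv]

theorem nodeEquiv_comp_eq_self {σ : ℕ → 𝕄 ≃[L] 𝕄} {η : List Bool} {c : γ → 𝕄}
    (h : ∀ i < η.length, σ i ∘ c = c) : nodeEquiv σ η ∘ c = c := by
  induction η generalizing σ with
  | nil => rfl
  | cons b η ih =>
    have tail : nodeEquiv (fun i => σ (i + 1)) η ∘ c = c :=
      ih fun i hi => h (i + 1) (Nat.succ_lt_succ hi)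
    have head : (bif b then σ 0 else .refl L 𝕄 : 𝕄 ≃[L] 𝕄) ∘ c = c := by
      cases b
      exacts [rfl, h 0 (Nat.zero_lt_succ _)]
    simp only [nodeEquiv, coe_equiv_comp_comp, tail, head]

/-- Since `c i` is fixed by the automorphisms selected above level `i`, the nodes `η1` and `ν ⊵ η0`
are moved by automorphisms which agree on it, and `hinc` applies. -/
theorem isSOP1TreeUpTo_nodeEquiv {φ : L.Formula (ξ ⊕ β)} {ψ : L.Formula (ξ ⊕ γ)} {n : ℕ}
    {e : ℕ → β → 𝕄} {c : ℕ → γ → 𝕄} {σ : ℕ → 𝕄 ≃[L] 𝕄}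
    (he : ∀ i j, i ≤ j → j < n → σ j ∘ e i = e i) (hc : ∀ i j, i < j → j < n → σ j ∘ c i = c i)
    (hcons : IsConsistent φ (e '' Set.Iic n))
    (hφψ : ∀ i < n, ∀ a, φ.Realize (Sum.elim a (σ i ∘ e (i + 1))) → ψ.Realize (Sum.elim a (c i)))
    (hinc : ∀ i j, i < j → j ≤ n → ∀ a, ψ.Realize (Sum.elim a (c i)) →
      ¬ φ.Realize (Sum.elim a (e j))) :
    IsSOP1TreeUpTo φ n fun η => nodeEquiv σ η ∘ e η.length where
  consistent {ν} hν := by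
    obtain ⟨a, ha⟩ := hcons
    refine ⟨nodeEquiv σ ν ∘ a, Set.forall_mem_image.2 ?_⟩
    rintro ρ ⟨μ, rfl⟩
    rw [List.length_append] at hν
    have fixed : nodeEquiv (fun i => σ (i + ρ.length)) μ ∘ e ρ.length = e ρ.length :=
      nodeEquiv_comp_eq_self fun i hi => he _ _ (by omega) (by omega)
    have extend : nodeEquiv σ ρ ∘ e ρ.length = nodeEquiv σ (ρ ++ μ) ∘ e ρ.length := by
      rw [nodeEquiv_append, coe_equiv_comp_comp, fixed]
    rw [extend, realize_equiv_comp]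
    exact ha _ ⟨_, by simp only [Set.mem_Iic]; omega, rfl⟩
  inconsistent {η ν} hν h := by
    obtain ⟨μ, rfl⟩ := h
    simp only [List.length_append, List.length_singleton] at hν
    rintro ⟨a, ha⟩
    have left := ha _ (.inl rfl)
    have right := ha _ (.inr rfl)
    simp only [nodeEquiv_append_singleton, nodeEquiv_append _ (η ++ [false]), List.length_append,
      List.length_singleton, cond_true, cond_false, Language.Equiv.comp_refl, coe_equiv_comp_comp,
      realize_equiv_comp_right (nodeEquiv σ η)] at left right
    set τ := nodeEquiv (fun i => σ (i + (η.length + 1))) μ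
    have fixed : τ ∘ c η.length = c η.length :=
      nodeEquiv_comp_eq_self fun i hi => hc _ _ (by omega) (by omega)
    refine hinc η.length _ (by omega) hν _ ?_ ((realize_equiv_comp_right τ φ _ _).1 left)
    rw [← realize_equiv_comp_right, fixed]
    exact hφψ _ (by omega) _ right

end AutomorphismTree

section KimLemma

variable {L : FirstOrder.Language.{u, v}} {𝕄 : Type w} [L.Structure 𝕄] {κ : Cardinal.{w}}
  {ξ ι : Type*} {A : Set 𝕄}

/-- The sequence of types `r, q, r, q, …`. -/
def alternate (q r : GlobalType L 𝕄 ι) (l : ℕ) : GlobalType L 𝕄 ι :=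
  if l % 2 = 1 then q else r

theorem alternate_two_mul (q r : GlobalType L 𝕄 ι) (l : ℕ) : alternate q r (2 * l) = r :=
  if_neg (by omega)

theorem alternate_two_mul_add_one (q r : GlobalType L 𝕄 ι) (l : ℕ) :
    alternate q r (2 * l + 1) = q :=
  if_pos (by omega)

theorem alternate_isInvariant {q r : GlobalType L 𝕄 ι} (hq : q.IsInvariant A)
    (hr : r.IsInvariant A) (l : ℕ) : (alternate q r l).IsInvariant A := by
  unfold alternate
  split_ifs
  exacts [hq, hr]

theorem alternate_realizedOver {q r : GlobalType L 𝕄 ι} {b : ι → 𝕄} (hq : q.RealizedOver A b)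
    (hr : r.RealizedOver A b) (l : ℕ) : (alternate q r l).RealizedOver A b := by
  unfold alternate
  split_ifs
  exacts [hq, hr]

/-- The indices of the terms in a subsequence of type `q, …, q, r, r, …`, with `q` repeated `N`
times, of a mixed Morley sequence in `alternate q r`. -/
def switchIndex (N l : ℕ) : ℕ :=
  2 * l + if l < N then 1 else 0

theorem switchIndex_strictMono (N : ℕ) : StrictMono (switchIndex N) :=
  strictMono_nat_of_lt_succ fun l => by
    unfold switchIndex
    split_ifs <;> omega

theorem exists_switch_threshold {ψ : L.Formula (ξ ⊕ ι)} {x : ℕ → ι → 𝕄}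
    (hodd : InstancesConsistent ψ fun l => x (2 * l + 1))
    (heven : ¬ InstancesConsistent ψ fun l => x (2 * l)) :
    ∃ n N₀, (∀ N, IsConsistent ψ (x ∘ switchIndex N '' Finset.range (N + n))) ∧
      ¬ IsConsistent ψ (x ∘ switchIndex N₀ '' Finset.range (N₀ + n + 1)) := by
  by_contra! step
  have all_consistent (n N : ℕ) :
      IsConsistent ψ (x ∘ switchIndex N '' Finset.range (N + n)) := by
    induction n generalizing N with
    | zero =>
      refine (hodd (Finset.range N)).imp fun a ha => Set.forall_mem_image.2 fun l hl => ?_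
      have hlN : l < N := by simpa using hl
      simpa only [Function.comp_apply, switchIndex, if_pos hlN] using ha l (Finset.mem_range.2 hlN)
    | succ n ih => exact step n N ih
  refine heven fun s => ?_
  obtain ⟨n, hn⟩ := s.exists_nat_subset_range
  refine (all_consistent n 0).imp fun a ha l hl => ?_
  simpa [switchIndex] using ha _ ⟨l, by simpa using hn hl, rfl⟩

theorem exists_blocks (n N : ℕ) :
    ∃ (p : ℕ → ℕ) (B : ℕ), (∀ i j, i < j → j ≤ n → p j + N < p i) ∧ ∀ i, p i + N < B := by
  refine ⟨fun i => (n - i) * (N + 1), (n + 1) * (N + 1), fun i j hij hj => ?_, fun i => ?_⟩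
  · have := Nat.mul_le_mul_right (N + 1) (show n - j + 1 ≤ n - i by omega)
    grind
  · have := Nat.mul_le_mul_right (N + 1) (show n - i + 1 ≤ n + 1 by omega)
    grind

/-- The indices of the terms which form a node of the tree: `N + 1` consecutive terms of type `q`
from the position `p` on, followed by `n` terms of type `r` from the position `B` on, which are
common to all nodes. -/
def blockIndex {N n : ℕ} (B p : ℕ) : Fin (N + 1) ⊕ Fin n → ℕ :=
  Sum.elim (fun k => 2 * (p + k) + 1) fun k => 2 * (B + k)

theorem exists_switchIndex_eq_blockIndex {N n B p : ℕ} (hB : p + N < B)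
    (k : Fin (N + 1) ⊕ Fin n) : ∃ l < B + n, switchIndex B l = blockIndex B p k := by
  rcases k with k | k
  · have hk : p + k < B := by omega
    exact ⟨p + k, by omega, by simp only [switchIndex, blockIndex, Sum.elim_inl, if_pos hk]⟩
  · exact ⟨B + k, by omega, by simp [switchIndex, blockIndex]⟩

variable {q r : GlobalType L 𝕄 ι} {x : ℕ → ι → 𝕄} {ψ : L.Formula (ξ ⊕ ι)}

theorem IsMixedMorleySequence.isConsistent_comp_iff [Nonempty 𝕄] (hq : q.IsInvariant A)
    (hr : r.IsInvariant A) (hx : IsMixedMorleySequence (alternate q r) A x) {h h' : ℕ → ℕ}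
    (hh : StrictMono h) (hh' : StrictMono h') (hmod : ∀ l, h l % 2 = h' l % 2) (s : Finset ℕ) :
    IsConsistent ψ (x ∘ h '' s) ↔ IsConsistent ψ (x ∘ h' '' s) := by
  have alternate_comp : alternate q r ∘ h = alternate q r ∘ h' := by
    ext1 l
    simp only [Function.comp_apply, alternate, hmod]
  have hx' := hx.comp_strictMono hh'
  rw [← alternate_comp] at hx'
  exact ((hx.comp_strictMono hh).sameType (fun l => alternate_isInvariant hq hr (h l))
    hx').isConsistent_iff ψ s

/-- A term of type `r` at the position `p' + N` continues the first `N` terms of the block at any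
position `p ≤ p'`. -/
theorem IsMixedMorleySequence.not_realize_blockIndex [Nonempty 𝕄] (hq : q.IsInvariant A)
    (hr : r.IsInvariant A) (hx : IsMixedMorleySequence (alternate q r) A x) {n N : ℕ}
    (hN : ¬ IsConsistent ψ (x ∘ switchIndex N '' Finset.range (N + n + 1))) {B p p' : ℕ}
    (hp : p ≤ p') (hB : p' + N < B) {a : ξ → 𝕄}
    (ha : ψ.Realize (Sum.elim a (x (2 * (p' + N))))) :
    ¬ ∀ k : Fin (N + 1) ⊕ Fin n, ψ.Realize (Sum.elim a (x (blockIndex B p k))) := by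
  intro hblock
  let h (l : ℕ) : ℕ := if l < N then 2 * (p + l) + 1 else
    if l = N then 2 * (p' + N) else 2 * (B + (l - (N + 1)))
  have hh : StrictMono h := strictMono_nat_of_lt_succ fun l => by
    simp only [h]
    split_ifs <;> omega
  have hmod (l : ℕ) : h l % 2 = switchIndex N l % 2 := by
    simp only [h, switchIndex]
    split_ifs <;> omega
  refine hN ((hx.isConsistent_comp_iff hq hr hh (switchIndex_strictMono N) hmod _).1 ⟨a, ?_⟩)
  refine Set.forall_mem_image.2 fun l hl => ?_
  have hl : l < N + n + 1 := by simpa using hl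
  simp only [Function.comp_apply, h]
  split_ifs with hlt heq
  · exact hblock (.inl ⟨l, by omega⟩)
  · exact ha
  · exact hblock (.inr ⟨l - (N + 1), by omega⟩)

theorem IsMixedMorleySequence.exists_isSOP1TreeUpTo [Nonempty 𝕄] [Countable ι]
    (h𝕄 : IsMonster L 𝕄 κ) (hA : IsSmall κ A) (hq : q.IsInvariant A) (hr : r.IsInvariant A)
    {b : ι → 𝕄} (hqb : q.RealizedOver A b) (hrb : r.RealizedOver A b)
    (hx : IsMixedMorleySequence (alternate q r) A x) {n N : ℕ}
    (hn : ∀ N, IsConsistent ψ (x ∘ switchIndex N '' Finset.range (N + n)))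
    (hN : ¬ IsConsistent ψ (x ∘ switchIndex N '' Finset.range (N + n + 1))) (m : ℕ) :
    ∃ t : List Bool → (Fin (N + 1) ⊕ Fin n) × ι → 𝕄,
      IsSOP1TreeUpTo (conjOver ψ Finset.univ) m t := by
  have sameType (i j : ℕ) : SameType L A (x i) (x j) := by
    have (i : ℕ) : SameType L A (x i) b :=
      ((hx i).mono Set.subset_union_left).sameType (alternate_realizedOver hqb hrb i)
    exact (this i).trans fun φ => (this j φ).symm
  obtain ⟨p, B, hp, hB⟩ := exists_blocks m N
  let e (i : ℕ) (k : Fin (N + 1) ⊕ Fin n) : ι → 𝕄 := x (blockIndex B (p i) k)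
  let c (i : ℕ) : ι → 𝕄 := x (2 * (p (i + 1) + N))
  have hσ (i : ℕ) : ∃ σ : 𝕄 ≃[L] 𝕄, σ ∘ e (i + 1) (.inl (Fin.last N)) = c i ∧
      ∀ l, 2 * (p (i + 1) + N) + 2 ≤ l → σ ∘ x l = x l :=
    hx.exists_equiv h𝕄 hA (alternate_isInvariant hq hr) (Nat.lt_succ_self _)
      (Nat.lt_succ_of_lt (Nat.lt_succ_self _)) (sameType _ _)
  choose σ hσ hσ_fix using hσ
  refine ⟨_, isSOP1TreeUpTo_nodeEquiv (ψ := ψ) (e := fun i => Function.uncurry (e i)) (c := c)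
    (σ := σ) ?_ ?_ ?_ ?_ ?_⟩
  · rintro i j hij hj
    have := hp i (j + 1) (by omega) hj
    have e_fix (k) : σ j ∘ e i k = e i k := hσ_fix j _ <| by
      rcases k with k | k <;> simp only [blockIndex, Sum.elim_inl, Sum.elim_inr] <;> grind
    exact funext fun z => congrFun (e_fix z.1) z.2
  · intro i j hij hj
    have := hp (i + 1) (j + 1) (by omega) hj
    exact hσ_fix j _ (by omega)
  · obtain ⟨a, ha⟩ := hn B
    refine ⟨a, Set.forall_mem_image.2 fun i _ => (realize_conjOver ..).2 fun k _ => ?_⟩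
    obtain ⟨l, hl, hlk⟩ := exists_switchIndex_eq_blockIndex (hB i) k
    exact ha _ ⟨l, by simpa using hl, congrArg x hlk⟩
  · intro i _ a ha
    have := (realize_conjOver ψ _ a fun k => σ i ∘ e (i + 1) k).1 ha (.inl (Fin.last N))
      (Finset.mem_univ _)
    rwa [hσ i] at this
  · intro i j hij hj a ha h
    have hp : p j ≤ p (i + 1) := by
      rcases Nat.eq_or_lt_of_le (Nat.succ_le_of_lt hij) with rfl | hlt
      exacts [le_rfl, (Nat.le_add_right _ N).trans (hp _ _ hlt hj).le]
    exact hx.not_realize_blockIndex hq hr hN hp (hB _) ha fun k =>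
      (realize_conjOver ..).1 h k (Finset.mem_univ _)

/-- Kim's lemma. -/
theorem IsIndependence.instancesConsistent_of_isMorleySequence [Nonempty 𝕄] [Countable ι]
    {Ind : Set 𝕄 → Set 𝕄 → Set 𝕄 → Prop} (hI : IsIndependence L κ Ind) (h𝕄 : IsMonster L 𝕄 κ)
    (hξ : IsSmall κ ξ) (hA : IsSmall κ A) (hq : q.IsInvariant A) (hr : r.IsInvariant A)
    {b : ι → 𝕄} (hqb : q.RealizedOver A b) (hrb : r.RealizedOver A b) {y z : ℕ → ι → 𝕄}
    (hy : IsMorleySequence q A y) (hψ : InstancesConsistent ψ y) (hz : IsMorleySequence r A z) :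
    InstancesConsistent ψ z := by
  by_contra hz_incons
  have hx := h𝕄.isMixedMorleySequence_morleySequence (.of_countable h𝕄.aleph0_lt ι) hA
    (alternate q r)
  set x := morleySequence (alternate q r) A
  have hodd : IsMixedMorleySequence (fun _ => q) A fun l => x (2 * l + 1) := by
    have := hx.comp_strictMono (h := fun l => 2 * l + 1) fun i j hij => by dsimp only; omega
    simpa only [Function.comp_def, alternate_two_mul_add_one] using this
  have heven : IsMixedMorleySequence (fun _ => r) A fun l => x (2 * l) := by
    have := hx.comp_strictMono (h := fun l => 2 * l) fun i j hij => by dsimp only; omega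
    simpa only [Function.comp_def, alternate_two_mul] using this
  obtain ⟨n, N, hn, hN⟩ := exists_switch_threshold
    ((hodd.instancesConsistent_iff (fun _ => hq) hy ψ).2 hψ)
    (mt (heven.instancesConsistent_iff (fun _ => hr) hz ψ).1 hz_incons)
  obtain ⟨t, ht⟩ := h𝕄.exists_isSOP1Tree (elementarilyEquivalent_iff.2 fun _ => .rfl) fun m =>
    hx.exists_isSOP1TreeUpTo h𝕄 hA hq hr hqb hrb hn hN m
  exact hI.not_isSOP1Tree h𝕄 hξ ht

end KimLemma

section KimIndependence

variable {L : FirstOrder.Language.{u, v}} {𝕄 : Type w} [L.Structure 𝕄] {κ : Cardinal.{w}}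
  {Ind : Set 𝕄 → Set 𝕄 → Set 𝕄 → Prop} {M : L.ElementarySubstructure 𝕄} {I ξ ι β γ δ : Type*}

theorem isMorleySequence_averageType_comp [Nonempty 𝕄] {U : Ultrafilter I} {t : I → γ → 𝕄}
    {A : Set 𝕄} {x : ℕ → γ → 𝕄} (hx : IsMorleySequence (averageType L U t) A x) (f : β → γ) :
    IsMorleySequence (averageType L U fun i => t i ∘ f) A fun i => x i ∘ f := fun i =>
  (realizedOver_averageType_comp (hx i) f).mono <| Set.union_subset_union_right _ <|
    Set.iUnion₂_mono fun _ _ => Set.range_comp_subset_range _ _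

theorem IsMonster.exists_isMorleySequence_averageType [Nonempty 𝕄] (h𝕄 : IsMonster L 𝕄 κ)
    (hM : IsSmall κ M) (hγ : IsSmall κ γ) (e : γ → 𝕄) :
    ∃ (W : Ultrafilter (γ → M)) (x : ℕ → γ → 𝕄),
      (averageType L W fun t z => (t z : 𝕄)).RealizedOver M e ∧
      IsMorleySequence (averageType L W fun t z => (t z : 𝕄)) M x := by
  obtain ⟨W, hW⟩ := exists_realizedOver_averageType M e
  exact ⟨W, _, hW, h𝕄.isMixedMorleySequence_morleySequence hγ hM fun _ => _⟩

namespace IsIndependence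

theorem exists_forall_lt_realize_conjugate [Nonempty 𝕄] (hI : IsIndependence L κ Ind)
    (h𝕄 : IsMonster L 𝕄 κ) (hM : IsSmall κ M) (hξ : IsSmall κ ξ) (hι : IsSmall κ ι)
    {a : ξ → 𝕄} {b : ι → 𝕄} (hab : Ind (Set.range a) M (Set.range b)) {U : Ultrafilter I}
    {t : I → ι → 𝕄} (ht : ∀ i z, t i z ∈ M) {σ : ℕ → 𝕄 ≃[L] 𝕄} (hσ : ∀ i, ∀ z ∈ M, σ i z = z)
    (hx : IsMorleySequence (averageType L U t) M fun i => σ i ∘ b) {θ : L.Formula (ξ ⊕ δ)}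
    {p : δ → 𝕄} (hp : ∀ z, p z ∈ (M : Set 𝕄) ∪ Set.range b) (hθ : θ.Realize (Sum.elim a p))
    (n : ℕ) :
    ∃ a' : ξ → 𝕄, SameType L (M : Set 𝕄) a' a ∧
      Ind (Set.range a') M (⋃ j < n, Set.range (σ j ∘ b)) ∧
      ∀ i < n, θ.Realize (Sum.elim a' (σ i ∘ p)) := by
  have hσp (i : ℕ) (z : δ) : σ i (p z) ∈ (M : Set 𝕄) ∪ Set.range (σ i ∘ b) := by
    rcases hp z with hz | ⟨y, hy⟩
    · exact .inl ((hσ i _ hz).symm ▸ hz)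
    · exact .inr ⟨y, congrArg (σ i) hy⟩
  have hB (n : ℕ) : IsSmall κ (⋃ j < n, Set.range (σ j ∘ b)) :=
    .biUnion_lt h𝕄.aleph0_lt n fun j => hι.range _
  induction n with
  | zero => exact ⟨a, .refl _ a, hI.mono hM hab (hξ.range a) (hι.range b) subset_rfl (by simp),
      by simp⟩
  | succ n ih =>
    obtain ⟨a', hsame, hind, ha'⟩ := ih
    obtain ⟨a'', ha''B, ha''b, hind'⟩ := hI.amalgam_conjugate hM hξ hι (hB n) hind hab hsame (hσ n)
      (hI.symm hM (hI.of_realizedOver_averageType hM ht (hB n) hι (hx n)) (hι.range _) (hB n))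
    refine ⟨a'', (ha''B.mono Set.subset_union_left).trans hsame, ?_, fun i hi => ?_⟩
    · rwa [Set.biUnion_lt_succ]
    rcases Nat.lt_succ_iff_lt_or_eq.1 hi with hi | rfl
    · refine (ha''B.realize_iff θ fun z => ?_).2 (ha' i hi)
      exact (hσp i z).imp_right (Set.mem_biUnion (t := fun j => Set.range (σ j ∘ b)) hi ·)
    · exact (ha''b.realize_iff θ (hσp i)).2 ((realize_equiv_comp (σ i) θ a p).2 hθ)

theorem exists_forall_realize_conjugate [Nonempty 𝕄] (hI : IsIndependence L κ Ind)
    (h𝕄 : IsMonster L 𝕄 κ) (hM : IsSmall κ M) (hξ : IsSmall κ ξ) (hι : IsSmall κ ι)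
    {a : ξ → 𝕄} {b : ι → 𝕄} (hab : Ind (Set.range a) M (Set.range b)) {U : Ultrafilter I}
    {t : I → ι → 𝕄} (ht : ∀ i z, t i z ∈ M) {σ : ℕ → 𝕄 ≃[L] 𝕄} (hσ : ∀ i, ∀ z ∈ M, σ i z = z)
    (hx : IsMorleySequence (averageType L U t) M fun i => σ i ∘ b) {θ : L.Formula (ξ ⊕ δ)}
    {p : δ → 𝕄} (hp : ∀ z, p z ∈ (M : Set 𝕄) ∪ Set.range b) (hθ : θ.Realize (Sum.elim a p)) :
    ∃ a' : ξ → 𝕄, ∀ i, θ.Realize (Sum.elim a' (σ i ∘ p)) := by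
  refine h𝕄.exists_realize_of_instancesConsistent hξ fun s => ?_
  obtain ⟨n, hn⟩ := s.exists_nat_subset_range
  obtain ⟨a', -, -, ha'⟩ :=
    hI.exists_forall_lt_realize_conjugate h𝕄 hM hξ hι hab ht hσ hx hp hθ n
  exact ⟨a', fun i hi => ha' i (Finset.mem_range.1 (hn hi))⟩

/-- By the pigeonhole principle one of the formulas is satisfied along a subsequence, which is again
a Morley sequence, so Kim's lemma applies to it. -/
theorem exists_not_kimDivides [Nonempty 𝕄] (hI : IsIndependence L κ Ind) (h𝕄 : IsMonster L 𝕄 κ)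
    (hM : IsSmall κ M) (hξ : IsSmall κ ξ) {U : Ultrafilter I} {t : I → γ → 𝕄}
    (ht : ∀ i z, t i z ∈ M) {e : γ → 𝕄} (he : (averageType L U t).RealizedOver M e)
    {x : ℕ → γ → 𝕄} (hx : IsMorleySequence (averageType L U t) M x) [Finite δ] {l : δ → ℕ}
    {ψ : ∀ j, L.Formula (ξ ⊕ Fin (l j))} {f : ∀ j, Fin (l j) → γ} {a : ξ → 𝕄}
    (ha : ∀ i, ∃ j, (ψ j).Realize (Sum.elim a (x i ∘ f j))) :
    ∃ j, ¬ KimDivides M (ψ j) (e ∘ f j) := by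
  classical
  choose j hj using ha
  obtain ⟨j₀, hj₀⟩ := Finite.exists_infinite_fiber j
  let h : ℕ ↪o ℕ := Nat.orderEmbeddingOfSet (j ⁻¹' {j₀})
  have hjh (n : ℕ) : j (h n) = j₀ :=
    (Nat.orderEmbeddingOfSet_range (j ⁻¹' {j₀})).subset ⟨n, rfl⟩
  refine ⟨j₀, fun ⟨r, hr, hre, y, hy, hy_incons⟩ => hy_incons ?_⟩
  have hxh : IsMorleySequence _ M fun n => x (h n) ∘ f j₀ := isMorleySequence_averageType_comp
    (IsMixedMorleySequence.comp_strictMono (s := fun _ => averageType L U t) hx h.strictMono) _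
  refine hI.instancesConsistent_of_isMorleySequence h𝕄 hξ hM
    (averageType_isInvariant fun i z => ht i _) hr (realizedOver_averageType_comp he _) hre hxh
    (fun s => ⟨a, fun n _ => ?_⟩) hy
  have := hj (h n)
  rwa [hjh n] at this

theorem kimIndep [Nonempty 𝕄] (hI : IsIndependence L κ Ind) (h𝕄 : IsMonster L 𝕄 κ)
    (hM : IsSmall κ M) (hξ : IsSmall κ ξ) (hι : IsSmall κ ι) {a : ξ → 𝕄} {b : ι → 𝕄}
    (hab : Ind (Set.range a) M (Set.range b)) : KimIndep L (M : Set 𝕄) a b := by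
  rintro ⟨m, φ, c, ⟨θ, hθa, hθφ⟩, k, l, ψ, d, hφψ, hdiv⟩
  let f (j : Fin k) (z : Fin (l j)) : ι ⊕ Σ j, Fin (l j) := .inr ⟨j, z⟩
  let e : (ι ⊕ Σ j, Fin (l j)) → 𝕄 := Sum.elim b fun z => d z.1 z.2
  have hγ := hι.sum h𝕄.aleph0_lt (.of_countable h𝕄.aleph0_lt (Σ j, Fin (l j)))
  obtain ⟨W, x, hW, hx⟩ := h𝕄.exists_isMorleySequence_averageType hM hγ e
  have hσ (i : ℕ) : ∃ σ : 𝕄 ≃[L] 𝕄, (∀ z ∈ M, σ z = z) ∧ ∀ z, σ (e z) = x i z :=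
    h𝕄.exists_equiv hγ hM (hW.sameType ((hx i).mono Set.subset_union_left))
  choose σ hσM hσ using hσ
  obtain rfl : (fun i => σ i ∘ e) = x := funext₂ hσ
  obtain ⟨a', ha'⟩ := hI.exists_forall_realize_conjugate h𝕄 hM hξ hι hab (fun t _ => (t _).2) hσM
    (isMorleySequence_averageType_comp hx Sum.inl) (fun z => z.2) hθa
  obtain ⟨j, hj⟩ := hI.exists_not_kimDivides h𝕄 hM hξ (fun t z => (t z).2) hW hx (ψ := ψ) (f := f)
    (a := a') fun i => by
      obtain ⟨j, hj⟩ := hφψ _ (hθφ _ ((realize_equiv_comp_right (σ i) θ a' _).1 (ha' i)))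
      exact ⟨j, (realize_equiv_comp_right (σ i) (ψ j) a' (d j)).2 hj⟩
  exact hj (hdiv j)

end IsIndependence

theorem kimDivides_restrictRight [Nonempty 𝕄] {U : Ultrafilter I} {t : I → γ → 𝕄} {A : Set 𝕄}
    (ht : ∀ i z, t i z ∈ A) {e : γ → 𝕄} (he : (averageType L U t).RealizedOver A e)
    {x : ℕ → γ → 𝕄} (hx : IsMorleySequence (averageType L U t) A x) {φ : L.Formula (ξ ⊕ γ)}
    (hφ : ¬ InstancesConsistent φ x) : KimDivides A (restrictRight φ) (e ∘ rightVars φ) :=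
  ⟨_, averageType_isInvariant fun i _ => ht i _, realizedOver_averageType_comp he _, _,
    isMorleySequence_averageType_comp hx _, fun h => hφ fun s => (h s).imp fun a ha i hi =>
      (realize_restrictRight φ a (x i)).1 (ha i hi)⟩

theorem typeKimForks_of_kimDivides_restrictRight {A B : Set 𝕄} {a : ξ → 𝕄} {φ : L.Formula (ξ ⊕ γ)}
    {e : γ → 𝕄} (hφ : φ.Realize (Sum.elim a e)) (he : ∀ z, e z ∈ B)
    (h : KimDivides A (restrictRight φ) (e ∘ rightVars φ)) : TypeKimForks L A B a :=
  ⟨_, restrictRight φ, e ∘ rightVars φ,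
    ⟨φ.relabel (Sum.map id fun z => ⟨e z, he z⟩), (realize_relabel_mem φ he a).2 hφ, fun a' ha' =>
      (realize_restrictRight φ a' e).2 ((realize_relabel_mem φ he a').1 ha')⟩,
    1, fun _ => _, fun _ => restrictRight φ, fun _ => e ∘ rightVars φ, fun _ ha' => ⟨0, ha'⟩,
    fun _ => h⟩

theorem IsIndependence.of_kimIndep [Nonempty 𝕄] (hI : IsIndependence L κ Ind)
    (h𝕄 : IsMonster L 𝕄 κ) (hwit : Witnessing L κ Ind) (hM : IsSmall κ M) {ξ ι : Type w}
    (hξ : IsSmall κ ξ) (hι : IsSmall κ ι) {a : ξ → 𝕄} {b : ι → 𝕄}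
    (hab : KimIndep L (M : Set 𝕄) a b) : Ind (Set.range a) M (Set.range b) := by
  by_contra hn
  obtain ⟨φ, hφ, hφ'⟩ := hI.strongFiniteCharacter M hM.lt ξ ι hξ.lt hι.lt a b hn
  let e : ι ⊕ M → 𝕄 := Sum.elim b (↑)
  have he : IsSmall κ (ι ⊕ M) := hι.sum h𝕄.aleph0_lt hM
  have not_ind_e {a' : ξ → 𝕄} (h : ¬ Ind (Set.range a') M (Set.range b)) :
      ¬ Ind (Set.range a') M (Set.range e) := fun h' =>
    h (hI.mono hM h' (hξ.range _) (he.range _) subset_rfl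
      (Set.range_subset_iff.2 fun z => ⟨.inl z, rfl⟩))
  obtain ⟨W, x, hW, hx⟩ := h𝕄.exists_isMorleySequence_averageType hM he e
  have hincons : ¬ InstancesConsistent φ x :=
    hwit M hM.lt ξ (ι ⊕ M) hξ.lt he.lt a e φ (not_ind_e hn) hφ
      (fun a' ha' => not_ind_e (hφ' a' ha')) _ (averageType_isInvariant fun t z => (t z).2) hW x hx
  refine hab (typeKimForks_of_kimDivides_restrictRight hφ ?_
    (kimDivides_restrictRight (fun t z => (t z).2) hW hx hincons))
  rintro (z | z)
  exacts [.inr ⟨z, rfl⟩, .inl z.2]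

end KimIndependence

end KimCriterion

theorem theorem9p1 {L : FirstOrder.Language.{u, v}} {T : L.Theory} (hT : T.IsComplete)
    {𝕄 : Type w} [L.Structure 𝕄] [Nonempty 𝕄] [𝕄 ⊨ T] {κ : Cardinal.{w}}
    (h𝕄 : KimCriterion.IsMonster L 𝕄 κ)
    (Ind : Set 𝕄 → Set 𝕄 → Set 𝕄 → Prop)
    (hinv : KimCriterion.Invariance L κ Ind)
    (hsfc : KimCriterion.StrongFiniteCharacter L κ Ind)
    (hex : KimCriterion.ExistenceOverModels L κ Ind)
    (hmon : KimCriterion.Monotonicity L κ Ind)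
    (hsym : KimCriterion.Symmetry L κ Ind)
    (hind : KimCriterion.IndependenceTheorem L κ Ind) :
    KimCriterion.IsNSOP1 T ∧
    (∀ M : L.ElementarySubstructure 𝕄, #M < κ →
      ∀ (ξ ι : Type w), #ξ < κ → #ι < κ → ∀ (a : ξ → 𝕄) (b : ι → 𝕄),
        Ind (Set.range a) M (Set.range b) → KimCriterion.KimIndep L (M : Set 𝕄) a b) ∧
    (KimCriterion.Witnessing L κ Ind →
      ∀ M : L.ElementarySubstructure 𝕄, #M < κ →
      ∀ (ξ ι : Type w), #ξ < κ → #ι < κ → ∀ (a : ξ → 𝕄) (b : ι → 𝕄),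
        Ind (Set.range a) M (Set.range b) ↔ KimCriterion.KimIndep L (M : Set 𝕄) a b) := by
  have hI : KimCriterion.IsIndependence L κ Ind := ⟨hinv, hsfc, hex, hmon, hsym, hind⟩
  have hkim (M : L.ElementarySubstructure 𝕄) (hM : #M < κ) (ξ ι : Type w) (hξ : #ξ < κ)
      (hι : #ι < κ) (a : ξ → 𝕄) (b : ι → 𝕄) (hab : Ind (Set.range a) M (Set.range b)) :
      KimCriterion.KimIndep L (M : Set 𝕄) a b :=
    hI.kimIndep h𝕄 (.of_lt hM) (.of_lt hξ) (.of_lt hι) hab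
  exact ⟨hI.isNSOP1 h𝕄 hT, hkim, fun hwit M hM ξ ι hξ hι a b =>
    ⟨hkim M hM ξ ι hξ hι a b, hI.of_kimIndep h𝕄 hwit (.of_lt hM) (.of_lt hξ) (.of_lt hι)⟩⟩
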